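/- Let $\mathcal H$ be the open upper half-plane and let $\mathcal M=\mathcal M(\mathcal H\times\mathbb C)$ be the field of meromorphic functions $f(\tau,\theta)$ on $\mathcal H\times\mathbb C$. Let $$\widehat{\mathbb C_q[\mathbb T]}=\bigoplus_{n\in\mathbb Z}\mathcal M\cdot y_{n\alpha^\vee},\qquad \big(f_1(\tau,\theta)\,y_{n_1\alpha^\vee}\big)*\big(f_2(\tau,\theta)\,y_{n_2\alpha^\vee}\big)=f_1(\tau,\theta)\,f_2(\tau,\theta+n_1\tau)\,y_{(n_1+n_2)\alpha^\vee}$$ be the extended quantum torus algebra, with commutative subalgebra $\widehat{\mathbb C_q[\mathbb T]}_0=\mathcal M\cdot 1$. For an invertible element $u$ write $\operatorname{Ad}_u(a)=u*a*u^{-1}$. All logarithms and powers of numbers in $\mathbb C\setminus\mathbb R_{\le 0}$ are principal. For $w\in\mathbb C\setminus\mathbb R_{\le 0}$ and $\eta\in\mathbb C$ put $$\Lambda(w,\eta\,|\,1)=\frac{\Gamma(w+\eta)\,e^{w}}{\sqrt{2\pi}\;w^{\eta+w-\frac12}} .$$ For $\operatorname{Re}\omega_1,\operatorname{Re}\omega_2>0$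 let $\Gamma_2(x\,|\,\omega_1,\omega_2)=\exp\big(\partial_s\zeta_2(s,x\,|\,\omega_1,\omega_2)|_{s=0}\big)$ be the Barnes double gamma function, where $\zeta_2(s,x\,|\,\omega_1,\omega_2)$ is the analytic continuation in $s$ of $\sum_{n_1,n_2\ge 0}(x+n_1\omega_1+n_2\omega_2)^{-s}$ ($\operatorname{Re}s>2$). It is meromorphic in $x\in\mathbb C$. It is continued analytically to all $\omega_1,\omega_2\in\mathbb C\setminus\mathbb R_{\le 0}$ with $|\arg\omega_1-\arg\omega_2|<\pi$ by the homogeneity relation $\Gamma_2(\lambda x\,|\,\lambda\omega_1,\lambda\omega_2)=\exp\big(-\tfrac12B_{2,2}(x\,|\,\omega_1,\omega_2)\log\lambda\big)\Gamma_2(x\,|\,\omega_1,\omega_2)$, where $$B_{2,2}(x\,|\,\omega_1,\omega_2)=\frac{x^2}{\omega_1\omega_2}-\Big(\frac1{\omega_1}+\frac1{\omega_2}\Big)x+\frac16\Big(\frac{\omega_2}{\omega_1}+\frac{\omega_1}{\omega_2}\Big)+\frac12 .$$ The modified double gamma function is $$F(w,\eta\,|\,\omega_1,\omega_2)=\Gamma_2(w+\eta\,|\,\omega_1,\omega_2)\,\exp\Big(\tfrac12B_{2,2}(w+\eta\,|\,\omega_1,\omega_2)\log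 w-\frac{3w^2}{4\omega_1\omega_2}-\frac{\eta w}{\omega_1\omega_2}+\frac{w(\omega_1+\omega_2)}{2\omega_1\omega_2}\Big).$$ **Theorem.** Let $z\in\mathbb C^*$ and $\ell_\pm=\pm\mathbb R_{>0}\cdot z$. For either choice of sign and every $t\in\mathbb C^*\setminus i\ell_\pm$, let $\Psi_\pm(t)$ be the unique automorphism of $\widehat{\mathbb C_q[\mathbb T]}$ which acts trivially on $\widehat{\mathbb C_q[\mathbb T]}_0$ and satisfies $$\Psi_\pm(t)(y_{\alpha^\vee})=\Lambda\Big(\pm\frac{z}{2\pi i t},\ \frac12\mp\Big(\theta+\frac\tau2\Big)\,\Big|\,1\Big)^{\pm1}\cdot y_{\alpha^\vee}.$$ Then $$\psi_\pm(t)=F\Big(\pm\frac{z}{2\pi i t},\ \frac{1+\tau}2\mp\theta\,\Big|\,1,\tau\Big)^{-1}$$ is, as a function of $(\tau,\theta)$, an invertible element of $\mathcal M\cdot 1=\widehat{\mathbb C_q[\mathbb T]}_0$, so that there are maps $\psi_\pm\colon\mathbb C^*\setminus i\ell_\pm\to\widehat{\mathbb C_q[\mathbb T]}$, and $$\Psi_\pm(t)=\operatorname{Ad}_{\psi_\pm(t)}.$$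 -/

import Mathlib

open Filter Topology

noncomputable section

namespace QuantumRH

/-! ### Meromorphic functions on an open subset of a complex normed space -/

section Meromorphic

variable {E : Type*} [NormedAddCommGroup E] [NormedSpace ℂ E]

/-- `f` is meromorphic on `U` (in possibly several complex variables): near each point of `U` it
is a quotient `g / h` of analytic functions, where `h` does not vanish identically near the point.
No condition is put on the values of `f` at the zeros of `h`. -/
def IsMeromorphicOn (U : Set E) (f : E → ℂ) : Prop :=
  ∀ p ∈ U, ∃ g h : E → ℂ, AnalyticAt ℂ g p ∧ AnalyticAt ℂ h p ∧ (∃ᶠ x in 𝓝 p, h x ≠ 0) ∧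
    ∀ᶠ x in 𝓝 p, h x ≠ 0 → f x = g x / h x

/-- The product of two analytic germs that are not zero is not zero. -/
lemma frequently_mul_ne_zero {p : E} {h k : E → ℂ} (hh : AnalyticAt ℂ h p)
    (hk : AnalyticAt ℂ k p) (hh0 : ∃ᶠ x in 𝓝 p, h x ≠ 0) (hk0 : ∃ᶠ x in 𝓝 p, k x ≠ 0) :
    ∃ᶠ x in 𝓝 p, h x * k x ≠ 0 := by
  intro hcon
  obtain ⟨r, hr, hball⟩ := Metric.eventually_nhds_iff_ball.1
    ((hcon.and hh.eventually_analyticAt).and hk.eventually_analyticAt)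
  obtain ⟨y, hy, hyb⟩ := (hh0.and_eventually (Metric.ball_mem_nhds p hr)).exists
  have hcont : ∀ᶠ x in 𝓝 y, h x ≠ 0 :=
    (hball y hyb).1.2.continuousAt.eventually_ne hy
  have hkz : k =ᶠ[𝓝 y] 0 := by
    filter_upwards [hcont, Metric.isOpen_ball.mem_nhds hyb] with x hx hxb
    have h1 := (hball x hxb).1.1
    rw [not_not] at h1
    exact (mul_eq_zero.1 h1).resolve_left hx
  have hk' : AnalyticOnNhd ℂ k (Metric.ball p r) := fun x hx => (hball x hx).2
  have hz := hk'.eqOn_zero_of_preconnected_of_eventuallyEq_zero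
    (convex_ball p r).isPreconnected hyb hkz
  exact hk0 (Filter.mem_of_superset (Metric.ball_mem_nhds p hr) fun x hx => by
    simpa using hz hx)

lemma IsMeromorphicOn.const (U : Set E) (c : ℂ) : IsMeromorphicOn U fun _ => c := fun _ _ =>
  ⟨fun _ => c, fun _ => 1, analyticAt_const, analyticAt_const,
    (Eventually.of_forall fun _ => one_ne_zero).frequently, Eventually.of_forall fun _ _ => by simp⟩

lemma IsMeromorphicOn.add {U : Set E} {f₁ f₂ : E → ℂ} (h₁ : IsMeromorphicOn U f₁)
    (h₂ : IsMeromorphicOn U f₂) : IsMeromorphicOn U (f₁ + f₂) := by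
  intro p hp
  obtain ⟨g, h, hg, hh, h0, e⟩ := h₁ p hp
  obtain ⟨g', h', hg', hh', h0', e'⟩ := h₂ p hp
  refine ⟨g * h' + h * g', h * h', (hg.mul hh').add (hh.mul hg'), hh.mul hh',
    frequently_mul_ne_zero hh hh' h0 h0', ?_⟩
  filter_upwards [e, e'] with x hx hx' hne
  simp only [Pi.mul_apply, Pi.add_apply] at hne ⊢
  obtain ⟨a, b⟩ := mul_ne_zero_iff.1 hne
  rw [hx a, hx' b, div_add_div _ _ a b]

lemma IsMeromorphicOn.mul {U : Set E} {f₁ f₂ : E → ℂ} (h₁ : IsMeromorphicOn U f₁)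
    (h₂ : IsMeromorphicOn U f₂) : IsMeromorphicOn U (f₁ * f₂) := by
  intro p hp
  obtain ⟨g, h, hg, hh, h0, e⟩ := h₁ p hp
  obtain ⟨g', h', hg', hh', h0', e'⟩ := h₂ p hp
  refine ⟨g * g', h * h', hg.mul hg', hh.mul hh', frequently_mul_ne_zero hh hh' h0 h0', ?_⟩
  filter_upwards [e, e'] with x hx hx' hne
  simp only [Pi.mul_apply] at hne ⊢
  obtain ⟨a, b⟩ := mul_ne_zero_iff.1 hne
  rw [hx a, hx' b, div_mul_div_comm]

lemma IsMeromorphicOn.neg {U : Set E} {f : E → ℂ} (hf : IsMeromorphicOn U f) :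
    IsMeromorphicOn U (-f) := by
  intro p hp
  obtain ⟨g, h, hg, hh, h0, e⟩ := hf p hp
  refine ⟨-g, h, hg.neg, hh, h0, ?_⟩
  filter_upwards [e] with x hx hne
  simp only [Pi.neg_apply]
  rw [hx hne, neg_div]

/-- The filter of all sets that contain an open set which is dense in `U`. -/
def genericFilter (U : TopologicalSpace.Opens E) : Filter E where
  sets := {S | ∃ V ⊆ S, IsOpen V ∧ (U : Set E) ⊆ closure V}
  univ_sets := ⟨Set.univ, subset_rfl, isOpen_univ, by simp⟩
  sets_of_superset := by
    rintro S T ⟨V, hV, ho, hd⟩ hST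
    exact ⟨V, hV.trans hST, ho, hd⟩
  inter_sets := by
    rintro S T ⟨V, hV, ho, hd⟩ ⟨W, hW, ho', hd'⟩
    refine ⟨V ∩ W, Set.inter_subset_inter hV hW, ho.inter ho', fun p hp => ?_⟩
    rw [mem_closure_iff]
    intro N hN hpN
    obtain ⟨y, ⟨hyN, hyU⟩, hyV⟩ := mem_closure_iff.1 (hd hp) (N ∩ U) (hN.inter U.isOpen) ⟨hpN, hp⟩
    obtain ⟨x, ⟨hxN, hxV⟩, hxW⟩ := mem_closure_iff.1 (hd' hyU) (N ∩ V) (hN.inter ho) ⟨hyN, hyV⟩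
    exact ⟨x, hxN, hxV, hxW⟩

/-- The ring `ℳ(U)` of meromorphic functions on the open set `U`: two functions which are
meromorphic on `U` are identified when they agree on an open dense subset of `U`, that is, when
they agree away from a proper analytic subset (on which their values carry no meaning). -/
def Mer (U : TopologicalSpace.Opens E) : Subring (Germ (genericFilter U) ℂ) where
  carrier := {φ | ∃ f : E → ℂ, IsMeromorphicOn (U : Set E) f ∧ φ = (f : Germ (genericFilter U) ℂ)}
  mul_mem' := by
    rintro _ _ ⟨f, hf, rfl⟩ ⟨g, hg, rfl⟩
    exact ⟨f * g, hf.mul hg, rfl⟩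
  one_mem' := ⟨fun _ => 1, .const _ 1, rfl⟩
  add_mem' := by
    rintro _ _ ⟨f, hf, rfl⟩ ⟨g, hg, rfl⟩
    exact ⟨f + g, hf.add hg, rfl⟩
  zero_mem' := ⟨fun _ => 0, .const _ 0, rfl⟩
  neg_mem' := by
    rintro _ ⟨f, hf, rfl⟩
    exact ⟨-f, hf.neg, rfl⟩

/-- `m : ℳ(U)` is the meromorphic function given by the formula `f`. -/
def Represents {U : TopologicalSpace.Opens E} (m : Mer U) (f : E → ℂ) : Prop :=
  (m : Germ (genericFilter U) ℂ) = (f : Germ (genericFilter U) ℂ)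

end Meromorphic

/-! ### The extended quantum torus algebra -/

/-- The domain `ℋ × ℂ` of the variables `(τ, θ)`, with `ℋ` the open upper half-plane. -/
def HC : TopologicalSpace.Opens (ℂ × ℂ) where
  carrier := {p | 0 < p.1.im}
  is_open' := isOpen_lt continuous_const (Complex.continuous_im.comp continuous_fst)

/-- The shift `(τ, θ) ↦ (τ, θ + n τ)`. -/
def shift (n : ℤ) (p : ℂ × ℂ) : ℂ × ℂ := (p.1, p.2 + n * p.1)

lemma shift_add (m n : ℤ) (p : ℂ × ℂ) : shift (m + n) p = shift n (shift m p) := by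
  simp only [shift, Prod.mk.injEq, true_and]
  push_cast
  ring

lemma shift_zero (p : ℂ × ℂ) : shift 0 p = p := by simp [shift]

lemma shift_mem {n : ℤ} {p : ℂ × ℂ} (hp : p ∈ HC) : shift n p ∈ HC := hp

lemma continuous_shift (n : ℤ) : Continuous (shift n) := by
  unfold shift
  fun_prop

lemma analyticAt_shift (n : ℤ) (p : ℂ × ℂ) : AnalyticAt ℂ (shift n) p :=
  analyticAt_fst.prod (analyticAt_snd.add (analyticAt_const.mul analyticAt_fst))

/-- The shift as a homeomorphism. -/
def shiftHomeo (n : ℤ) : (ℂ × ℂ) ≃ₜ (ℂ × ℂ) where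
  toFun := shift n
  invFun := shift (-n)
  left_inv p := by rw [← shift_add, add_neg_cancel, shift_zero]
  right_inv p := by rw [← shift_add, neg_add_cancel, shift_zero]
  continuous_toFun := continuous_shift n
  continuous_invFun := continuous_shift (-n)

lemma tendsto_shift (n : ℤ) : Tendsto (shift n) (genericFilter HC) (genericFilter HC) := by
  rintro S ⟨V, hV, ho, hd⟩
  refine ⟨shift n ⁻¹' V, Set.preimage_mono hV, ho.preimage (continuous_shift n), fun p hp => ?_⟩
  have h := (shiftHomeo n).preimage_closure V
  change shift n ⁻¹' closure V = closure (shift n ⁻¹' V) at h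
  rw [← h]
  exact hd (shift_mem hp)

lemma IsMeromorphicOn.comp_shift {f : ℂ × ℂ → ℂ} (hf : IsMeromorphicOn (HC : Set (ℂ × ℂ)) f)
    (n : ℤ) : IsMeromorphicOn (HC : Set (ℂ × ℂ)) (f ∘ shift n) := by
  intro p hp
  obtain ⟨g, h, hg, hh, h0, e⟩ := hf (shift n p) (shift_mem hp)
  have hmap : map (shift n) (𝓝 p) = 𝓝 (shift n p) := (shiftHomeo n).map_nhds_eq p
  refine ⟨g ∘ shift n, h ∘ shift n, hg.comp (analyticAt_shift n p),
    hh.comp (analyticAt_shift n p), ?_, ?_⟩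
  · rw [← hmap] at h0
    exact frequently_map.1 h0
  · rw [← hmap] at e
    exact eventually_map.1 e

/-- The action of `n : ℤ` on `ℳ(ℋ × ℂ)`, sending `f(τ, θ)` to `f(τ, θ + n τ)`. -/
def shiftMer (n : ℤ) (m : Mer HC) : Mer HC :=
  ⟨(m : Germ (genericFilter HC) ℂ).compTendsto (shift n) (tendsto_shift n), by
    obtain ⟨_, f, hf, rfl⟩ := m
    exact ⟨f ∘ shift n, hf.comp_shift n, rfl⟩⟩

instance : MulSemiringAction (Multiplicative ℤ) (Mer HC) where
  smul n m := shiftMer n.toAdd m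
  one_smul := by
    rintro ⟨_, f, hf, rfl⟩
    refine Subtype.ext (congrArg (fun u : ℂ × ℂ → ℂ => (u : Germ (genericFilter HC) ℂ)) ?_)
    exact funext fun p => congrArg f (shift_zero p)
  mul_smul := by
    rintro a b ⟨_, f, hf, rfl⟩
    refine Subtype.ext (congrArg (fun u : ℂ × ℂ → ℂ => (u : Germ (genericFilter HC) ℂ)) ?_)
    exact funext fun p => congrArg f (shift_add a.toAdd b.toAdd p)
  smul_zero _ := rfl
  smul_add := by
    rintro a ⟨_, f, hf, rfl⟩ ⟨_, g, hg, rfl⟩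
    rfl
  smul_one _ := rfl
  smul_mul := by
    rintro a ⟨_, f, hf, rfl⟩ ⟨_, g, hg, rfl⟩
    rfl

/-- The extended quantum torus algebra `⨁ n : ℤ, ℳ(ℋ × ℂ) · y_{n α^∨}` with the product
`(f₁(τ, θ) y_{n₁ α^∨}) * (f₂(τ, θ) y_{n₂ α^∨}) = f₁(τ, θ) f₂(τ, θ + n₁ τ) y_{(n₁ + n₂) α^∨}`. -/
abbrev ExtTorus : Type := SkewMonoidAlgebra (Mer HC) (Multiplicative ℤ)

/-- The embedding `f ↦ f · 1` of `ℳ(ℋ × ℂ)` as the degree zero subalgebra. -/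
abbrev degZero : Mer HC →+* ExtTorus := SkewMonoidAlgebra.singleOneRingHom

/-- The element `f · y_{n α^∨}`. -/
abbrev monom (f : Mer HC) (n : ℤ) : ExtTorus :=
  SkewMonoidAlgebra.single (Multiplicative.ofAdd n) f

lemma monom_mul_monom (f₁ f₂ : Mer HC) (n₁ n₂ : ℤ) :
    monom f₁ n₁ * monom f₂ n₂ = monom (f₁ * shiftMer n₁ f₂) (n₁ + n₂) :=
  SkewMonoidAlgebra.single_mul_single

/-- The inner automorphism `Ad_u : a ↦ u * a * u⁻¹`. -/
def Ad {R : Type*} [Ring R] (u : Rˣ) : R ≃+* R where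
  toFun a := u * a * ↑u⁻¹
  invFun a := ↑u⁻¹ * a * u
  left_inv a := by simp [mul_assoc]
  right_inv a := by simp [mul_assoc]
  map_mul' a b := by simp [mul_assoc]
  map_add' a b := by simp [mul_add, add_mul]

/-! ### Special functions -/

/-- The Barnes double zeta series `∑_{n₁, n₂ ≥ 0} (x + n₁ a + n₂ b)^{-s}`, absolutely convergent
for `Re s > 2` when `Re a, Re b > 0`. -/
def barnesZeta2Series (x a b s : ℂ) : ℂ :=
  ∑' n : ℕ × ℕ, (x + n.1 * a + n.2 * b) ^ (-s)

open Classical in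
/-- The analytic continuation in `s` of the Barnes double zeta function to the region
`Re s > -1`, `s ≠ 1, 2` (which is connected, so that the continuation is unique there). Only its
germ at `s = 0` is used. -/
def barnesZeta2 (x a b : ℂ) : ℂ → ℂ :=
  if h : ∃ Z : ℂ → ℂ, AnalyticOnNhd ℂ Z ({s | -1 < s.re} \ {1, 2}) ∧
      ∀ s : ℂ, 2 < s.re → Z s = barnesZeta2Series x a b s
  then h.choose else 0

/-- The Barnes double gamma function `Γ₂(x | a, b) = exp (∂/∂s ζ₂(s, x | a, b) |_{s = 0})` for
parameters with `Re a, Re b > 0`. The choice of the branches of the powers with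
`x + n₁ a + n₂ b` in the left half-plane (finitely many) does not affect the exponential. The
values at the poles `x = - n₁ a - n₂ b` carry no meaning. -/
def barnesGamma2RightHalf (x a b : ℂ) : ℂ :=
  Complex.exp (deriv (barnesZeta2 x a b) 0)

/-- The double Bernoulli polynomial `B_{2,2}(x | a, b)`. -/
def bernoulli22 (x a b : ℂ) : ℂ :=
  x ^ 2 / (a * b) - (1 / a + 1 / b) * x + (b / a + a / b) / 6 + 1 / 2

/-- The Barnes double gamma function `Γ₂(x | a, b)` for `a, b ∉ ℝ_{≤ 0}` with
`|arg a - arg b| < π`, continued analytically from `Re a, Re b > 0` by means of the homogeneity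
`Γ₂(l x | l a, l b) = exp (-(1/2) B_{2,2}(x | a, b) log l) Γ₂(x | a, b)`, applied with
`log l = -(log a + log b) / 2`. For this `l` the parameters `l a`, `l b` have arguments
`±(arg a - arg b) / 2` and so lie in the right half-plane. -/
def barnesGamma2 (x a b : ℂ) : ℂ :=
  let logl : ℂ := -(Complex.log a + Complex.log b) / 2
  let l : ℂ := Complex.exp logl
  Complex.exp (bernoulli22 x a b * logl / 2) * barnesGamma2RightHalf (l * x) (l * a) (l * b)

/-- The modified gamma function
`Λ(w, η | 1) = Γ(w + η) e^w / (√(2π) w^{η + w - 1/2})`, `w ∉ ℝ_{≤ 0}`. -/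
def modGamma (w η : ℂ) : ℂ :=
  Complex.Gamma (w + η) * Complex.exp w /
    ((Real.sqrt (2 * Real.pi) : ℂ) * w ^ (η + w - 1 / 2))

/-- The modified double gamma function `F(w, η | a, b)`, `w ∉ ℝ_{≤ 0}`. -/
def modGamma2 (w η a b : ℂ) : ℂ :=
  barnesGamma2 (w + η) a b * Complex.exp (bernoulli22 (w + η) a b * Complex.log w / 2) *
    Complex.exp (-(3 * w ^ 2) / (4 * a * b) - η * w / (a * b) + w * (a + b) / (2 * a * b))

/-! ### The solutions -/

/-- The domain `ℂ^* \ iℓ_±`, where `ℓ_± = ± ℝ_{>0} z`. The sign `±` is `σ`. -/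
def tDomain (z : ℂ) (σ : ℤˣ) : Set ℂ :=
  {t | t ≠ 0 ∧ ∀ r : ℝ, 0 < r → t ≠ Complex.I * ((σ : ℤ) * r * z)}

/-- The argument `w = ± z / (2 π i t)`. -/
def wArg (z : ℂ) (σ : ℤˣ) (t : ℂ) : ℂ := (σ : ℤ) * z / (2 * Real.pi * Complex.I * t)

/-- `Ψ` is the automorphism `Ψ_±(t)`: it acts trivially on the degree zero subalgebra, and
`Ψ(y_{α^∨}) = Λ(± z / (2 π i t), 1/2 ∓ (θ + τ/2) | 1)^{±1} · y_{α^∨}`. -/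
structure IsSolution (z : ℂ) (σ : ℤˣ) (t : ℂ) (Ψ : ExtTorus ≃+* ExtTorus) : Prop where
  degZero_fixed : ∀ f : Mer HC, Ψ (degZero f) = degZero f
  map_y : ∃ L : Mer HC,
    Represents L (fun p => modGamma (wArg z σ t) (1 / 2 - (σ : ℤ) * (p.2 + p.1 / 2)) ^ (σ : ℤ)) ∧
    Ψ (monom 1 1) = monom L 1

/-- The formula `F(± z / (2 π i t), (1 + τ)/2 ∓ θ | 1, τ)⁻¹` for `ψ_±(t)`, as a function of
`(τ, θ)`. -/
def psiFun (z : ℂ) (σ : ℤˣ) (t : ℂ) (p : ℂ × ℂ) : ℂ :=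
  (modGamma2 (wArg z σ t) ((1 + p.1) / 2 - (σ : ℤ) * p.2) 1 p.1)⁻¹

end QuantumRH

end

open QuantumRH

/-!
Both automorphisms in `Ψ = Ad ψ` fix the degree zero subalgebra, and `Ad ψ` sends `y_{α^∨}` to
`ψ(τ, θ) ψ(τ, θ + τ)⁻¹ y_{α^∨}`. Since an automorphism is determined by these data
(`ringEquiv_ext`), the theorem is the difference equation
`F(w, η | 1, τ) = Λ(w, η | 1) F(w, η + τ | 1, τ)` (`modGamma2_shift`), together with the fact that
`F` and `1 / F` are meromorphic in `(τ, θ)` jointly (`isMeromorphicOn_modGamma2`,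
`isMeromorphicOn_inv_modGamma2`). The exponential factors of `F` turn the difference equation into
`Γ₂(x | 1, τ) = Γ(x) / √(2π) · Γ₂(x + τ | 1, τ)` (`barnesGamma2_shift`).

The double gamma function is defined through an analytic continuation, so this continuation has to
be constructed. With `H(u, s)` the Euler–Maclaurin antidifference of `u ^ (-s)` for the steps `a`
and `b` (`antidiff2`), the error `u ^ (-s) - (second difference of H)(u)` is `O(|u| ^ (-s - 3))`,
by Taylor's formula with uniform remainder (`add_cpow_taylor`, `error2_bound`). Hence
`H(x, s) + ∑ error(x + m a + n b, s)` converges for `Re s > -1`; it equals the Barnes zeta series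
for `Re s > 2` because the second differences telescope (`IsFarRight.exists_continuation`). This is
done for `x` far to the right, where no power crosses the branch cut, and other `x` are reached by
adding the zeta functions of the progressions `x + n a`. These are continued in the same way, and
the derivative at `s = 0` of such a function is computed by Euler's limit for the gamma function and
Stirling's formula (`exists_continuation_progression`). Continuations agree near `s = 0`
(`IsContinuation.eventuallyEq`), so comparing the series for `x` and for `x + b` gives the
difference equation of `Γ₂`.

For meromorphy, the difference equation is iterated to write `Γ₂(x | 1, τ)` locally as a finite
product of gamma functions times `Γ₂(x + N τ | 1, τ)` with `x + N τ` far to the right. The latter is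
the exponential of a series of analytic functions of `(τ, θ)` that is dominated by constants
(`exists_errorLog2_majorant`), and such a series is analytic by Osgood's lemma
(`analyticAt_of_separately`).
-/

noncomputable section

namespace QuantumRH

/-! ### Osgood's lemma and series of analytic functions of two variables -/

open MeasureTheory in
/-- The double contour integral of `f` against a bounded kernel over the torus `|ζ₁ - p₁| = r`,
`|ζ₂ - p₂| = r`, as a continuous linear functional of the kernel. -/
lemma exists_torus_functional {f : ℂ × ℂ → ℂ} {p : ℂ × ℂ} {r : ℝ} (hr : 0 < r)
    (hf : ContinuousOn f (Metric.closedBall p r)) :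
    ∃ L : (BoundedContinuousFunction (ℝ × ℝ) ℂ) →L[ℂ] ℂ, ∀ g,
      L g = ∫ s in (0 : ℝ)..2 * Real.pi, ∫ t in (0 : ℝ)..2 * Real.pi,
        f (circleMap p.1 r s, circleMap p.2 r t) *
          (deriv (circleMap p.1 r) s * deriv (circleMap p.2 r) t) * g (s, t) := by
  have hmem : ∀ q : ℝ × ℝ, (circleMap p.1 r q.1, circleMap p.2 r q.2) ∈ Metric.closedBall p r := by
    intro q
    rw [← closedBall_prod_same]
    exact ⟨circleMap_mem_closedBall _ hr.le _, circleMap_mem_closedBall _ hr.le _⟩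
  set k : ℝ × ℝ → ℂ := fun q => f (circleMap p.1 r q.1, circleMap p.2 r q.2) *
          (deriv (circleMap p.1 r) q.1 * deriv (circleMap p.2 r) q.2) with hk
  have hkc : Continuous k := by
    refine Continuous.mul ?_ ?_
    · exact hf.comp_continuous (by fun_prop) hmem
    · simp only [deriv_circleMap]
      fun_prop
  have hcomp : IsCompact (Metric.closedBall p r) := isCompact_closedBall p r
  obtain ⟨M, hM⟩ := hcomp.exists_bound_of_continuousOn hf
  have hM0 : 0 ≤ M := (norm_nonneg _).trans (hM p (Metric.mem_closedBall_self hr.le))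
  have hkb : ∀ q, ‖k q‖ ≤ M * (r * r) := by
    intro q
    simp only [hk, norm_mul, deriv_circleMap, norm_circleMap_zero, Complex.norm_I, mul_one,
      abs_of_pos hr]
    gcongr
    exact hM _ (hmem q)
  have hint : ∀ g : BoundedContinuousFunction (ℝ × ℝ) ℂ,
      Continuous fun s : ℝ => ∫ t in (0 : ℝ)..2 * Real.pi, k (s, t) * g (s, t) := by
    intro g
    apply intervalIntegral.continuous_parametric_intervalIntegral_of_continuous'
      (f := fun s t => k (s, t) * g (s, t))
    exact hkc.mul g.continuous
  have hint' : ∀ (g : BoundedContinuousFunction (ℝ × ℝ) ℂ) (s : ℝ),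
      Continuous fun t : ℝ => k (s, t) * g (s, t) := by
    intro g s
    have := hkc.mul g.continuous
    exact this.comp (by fun_prop : Continuous fun t : ℝ => (s, t))
  let L₀ : (BoundedContinuousFunction (ℝ × ℝ) ℂ) →ₗ[ℂ] ℂ :=
    { toFun := fun g =>
        ∫ s in (0 : ℝ)..2 * Real.pi, ∫ t in (0 : ℝ)..2 * Real.pi, k (s, t) * g (s, t)
      map_add' := by
        intro g₁ g₂
        rw [← intervalIntegral.integral_add ((hint g₁).intervalIntegrable _ _)
          ((hint g₂).intervalIntegrable _ _)]
        congr 1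
        ext s
        rw [← intervalIntegral.integral_add ((hint' g₁ s).intervalIntegrable _ _)
          ((hint' g₂ s).intervalIntegrable _ _)]
        simp [mul_add]
      map_smul' := by
        intro c g
        simp only [RingHom.id_apply, smul_eq_mul]
        rw [← intervalIntegral.integral_const_mul]
        congr 1
        ext s
        rw [← intervalIntegral.integral_const_mul]
        congr 1
        ext t
        simp only [BoundedContinuousFunction.coe_smul, smul_eq_mul]
        ring }
  refine ⟨L₀.mkContinuous (M * (r * r) * |2 * Real.pi - 0| * |2 * Real.pi - 0|) ?_, fun g => rfl⟩
  intro g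
  have h1 : ∀ s : ℝ, ‖∫ t in (0 : ℝ)..2 * Real.pi, k (s, t) * g (s, t)‖ ≤
      M * (r * r) * ‖g‖ * |2 * Real.pi - 0| := by
    intro s
    apply intervalIntegral.norm_integral_le_of_norm_le_const
    intro t _
    rw [norm_mul]
    gcongr
    · exact hkb _
    · exact g.norm_coe_le_norm _
  have h2 : ‖∫ s in (0 : ℝ)..2 * Real.pi, ∫ t in (0 : ℝ)..2 * Real.pi, k (s, t) * g (s, t)‖ ≤
      M * (r * r) * ‖g‖ * |2 * Real.pi - 0| * |2 * Real.pi - 0| :=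
    intervalIntegral.norm_integral_le_of_norm_le_const fun s _ => h1 s
  calc _ ≤ _ := h2
    _ = _ := by ring

/-- The Cauchy kernel in one of the variables of the torus depends analytically on its centre,
because inversion in the Banach algebra of bounded continuous functions is analytic. -/
lemma exists_cauchy_kernel {c : ℂ} {r : ℝ} (hr : 0 < r) (φ : ℝ × ℝ → ℝ) (hφ : Continuous φ) :
    ∃ K : ℂ → BoundedContinuousFunction (ℝ × ℝ) ℂ, AnalyticAt ℂ K c ∧
      ∀ z ∈ Metric.ball c r, ∀ q, K z q = (circleMap c r (φ q) - z)⁻¹ := by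
  let A : BoundedContinuousFunction (ℝ × ℝ) ℂ :=
    BoundedContinuousFunction.ofNormedAddCommGroup (fun q => circleMap c r (φ q)) (by fun_prop)
      (‖c‖ + r) (fun q => by
        have := circleMap_mem_closedBall c hr.le (φ q)
        rw [mem_closedBall_iff_norm] at this
        linarith [norm_le_norm_add_norm_sub' (circleMap c r (φ q)) c])
  have hA : ∀ q, A q = circleMap c r (φ q) := fun _ => rfl
  let one := (1 : BoundedContinuousFunction (ℝ × ℝ) ℂ)
  have hinv : ∀ z ∈ Metric.ball c r, ∃ I : BoundedContinuousFunction (ℝ × ℝ) ℂ,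
      (∀ q, I q = (circleMap c r (φ q) - z)⁻¹) := by
    intro z hz
    have hz' : ‖z - c‖ < r := mem_ball_iff_norm.1 hz
    have hlow : ∀ q, r - ‖z - c‖ ≤ ‖circleMap c r (φ q) - z‖ := by
      intro q
      have h1 : ‖circleMap c r (φ q) - c‖ = r := by
        simp [circleMap, abs_of_pos hr]
      have h2 : circleMap c r (φ q) - c = (circleMap c r (φ q) - z) + (z - c) := by ring
      have := norm_add_le (circleMap c r (φ q) - z) (z - c)
      rw [← h2, h1] at this
      linarith
    refine ⟨BoundedContinuousFunction.ofNormedAddCommGroup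
      (fun q => (circleMap c r (φ q) - z)⁻¹) ?_ (r - ‖z - c‖)⁻¹ ?_, fun q => rfl⟩
    · apply Continuous.inv₀ (by fun_prop)
      intro q hq
      have := hlow q
      rw [hq, norm_zero] at this
      linarith
    · intro q
      rw [norm_inv]
      exact inv_anti₀ (by linarith) (hlow q)
  have hne : ∀ z ∈ Metric.ball c r, ∀ q, circleMap c r (φ q) - z ≠ 0 := by
    intro z hz q hq
    have h1 : ‖circleMap c r (φ q) - c‖ = r := by simp [circleMap, abs_of_pos hr]
    rw [sub_eq_zero.1 hq] at h1
    exact absurd (mem_ball_iff_norm.1 hz) (by linarith)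
  have hunit : ∀ z ∈ Metric.ball c r, ∃ u : (BoundedContinuousFunction (ℝ × ℝ) ℂ)ˣ,
      (u : BoundedContinuousFunction (ℝ × ℝ) ℂ) = A - z • one ∧
      ∀ q, (↑u⁻¹ : BoundedContinuousFunction (ℝ × ℝ) ℂ) q = (circleMap c r (φ q) - z)⁻¹ := by
    intro z hz
    obtain ⟨I, hI⟩ := hinv z hz
    refine ⟨⟨A - z • one, I, ?_, ?_⟩, rfl, hI⟩
    · ext q
      simp [one, hA, hI, mul_inv_cancel₀ (hne z hz q)]
    · ext q
      simp [one, hA, hI, inv_mul_cancel₀ (hne z hz q)]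
  refine ⟨fun z => Ring.inverse (A - z • one), ?_, ?_⟩
  · obtain ⟨u, hu, -⟩ := hunit c (Metric.mem_ball_self hr)
    have h1 : AnalyticAt ℂ (Ring.inverse : BoundedContinuousFunction (ℝ × ℝ) ℂ → _)
        (A - c • one) := by
      rw [← hu]
      exact analyticAt_inverse (𝕜 := ℂ) u
    have h2 : AnalyticAt ℂ (fun z : ℂ => A - z • one) c :=
      analyticAt_const.sub (analyticAt_id.smul analyticAt_const)
    exact h1.comp (f := fun z : ℂ => A - z • one) h2
  · intro z hz q
    obtain ⟨u, hu, hu'⟩ := hunit z hz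
    change Ring.inverse (A - z • one) q = _
    rw [← hu, Ring.inverse_unit, hu']

/-- **Osgood's lemma** in two variables: a continuous function which is holomorphic in each
variable is analytic. The Cauchy integral over a torus writes it as a continuous linear functional
of a kernel that is analytic as a map into a Banach algebra. -/
lemma analyticAt_of_separately {f : ℂ × ℂ → ℂ} {p : ℂ × ℂ} {r : ℝ} (hr : 0 < r)
    (hf : ContinuousOn f (Metric.closedBall p r))
    (h1 : ∀ z₂ ∈ Metric.closedBall p.2 r,
      DifferentiableOn ℂ (fun z₁ => f (z₁, z₂)) (Metric.closedBall p.1 r))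
    (h2 : ∀ z₁ ∈ Metric.closedBall p.1 r,
      DifferentiableOn ℂ (fun z₂ => f (z₁, z₂)) (Metric.closedBall p.2 r)) :
    AnalyticAt ℂ f p := by
  obtain ⟨L, hL⟩ := exists_torus_functional hr hf
  obtain ⟨K₁, hK₁, hK₁'⟩ := exists_cauchy_kernel (c := p.1) hr (Prod.fst : ℝ × ℝ → ℝ) continuous_fst
  obtain ⟨K₂, hK₂, hK₂'⟩ := exists_cauchy_kernel (c := p.2) hr (Prod.snd : ℝ × ℝ → ℝ) continuous_snd
  have hK : AnalyticAt ℂ (fun z : ℂ × ℂ => K₁ z.1 * K₂ z.2) p :=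
    (hK₁.comp (f := Prod.fst) (x := p) analyticAt_fst).mul
      (hK₂.comp (f := Prod.snd) (x := p) analyticAt_snd)
  have hLK : AnalyticAt ℂ (fun z : ℂ × ℂ =>
      (2 * Real.pi * Complex.I : ℂ)⁻¹ *
        ((2 * Real.pi * Complex.I : ℂ)⁻¹ * L (K₁ z.1 * K₂ z.2))) p :=
    analyticAt_const.mul (analyticAt_const.mul ((L.analyticAt _).comp hK))
  refine hLK.congr ?_
  filter_upwards [Metric.ball_mem_nhds p hr] with z hz
  rw [← ball_prod_same] at hz
  obtain ⟨hz1, hz2⟩ := hz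
  rw [hL]
  have e1 : ∀ s : ℝ, (∫ t in (0 : ℝ)..2 * Real.pi,
        f (circleMap p.1 r s, circleMap p.2 r t) *
          (deriv (circleMap p.1 r) s * deriv (circleMap p.2 r) t) * (K₁ z.1 * K₂ z.2) (s, t)) =
      (2 * Real.pi * Complex.I : ℂ) * (deriv (circleMap p.1 r) s •
        ((circleMap p.1 r s - z.1)⁻¹ • f (circleMap p.1 r s, z.2))) := by
    intro s
    have hc := (h2 (circleMap p.1 r s)
      (circleMap_mem_closedBall _ hr.le _)).circleIntegral_sub_inv_smul hz2
    rw [circleIntegral] at hc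
    simp only [smul_eq_mul] at hc ⊢
    have : (2 * Real.pi * Complex.I : ℂ) * (deriv (circleMap p.1 r) s *
        ((circleMap p.1 r s - z.1)⁻¹ * f (circleMap p.1 r s, z.2))) =
        deriv (circleMap p.1 r) s * (circleMap p.1 r s - z.1)⁻¹ *
        ((2 * Real.pi * Complex.I : ℂ) * f (circleMap p.1 r s, z.2)) := by ring
    rw [this, ← hc, ← intervalIntegral.integral_const_mul]
    congr 1
    ext t
    simp only [BoundedContinuousFunction.coe_mul, Pi.mul_apply]
    rw [hK₁' z.1 hz1, hK₂' z.2 hz2]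
    ring
  simp_rw [e1]
  rw [intervalIntegral.integral_const_mul]
  have hc := (h1 z.2 (Metric.ball_subset_closedBall hz2)).circleIntegral_sub_inv_smul hz1
  rw [circleIntegral] at hc
  rw [hc]
  have hpi : (2 * Real.pi * Complex.I : ℂ) ≠ 0 := Complex.two_pi_I_ne_zero
  simp only [smul_eq_mul]
  field_simp

/-- A series of analytic functions of two variables which is dominated by a convergent series of
constants near a point is analytic there. -/
lemma analyticAt_tsum_of_summable {ι : Type*} {F : ι → ℂ × ℂ → ℂ} {M : ι → ℝ} {p : ℂ × ℂ}
    (hM : Summable M)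
    (hF : ∀ᶠ q in 𝓝 p, ∀ n, AnalyticAt ℂ (F n) q ∧ ‖F n q‖ ≤ M n) :
    AnalyticAt ℂ (fun q => ∑' n, F n q) p := by
  obtain ⟨R, hR, hball⟩ := Metric.eventually_nhds_iff_ball.1 hF
  have hr : 0 < R / 2 := by linarith
  have hsub : Metric.closedBall p (R / 2) ⊆ Metric.ball p R :=
    Metric.closedBall_subset_ball (by linarith)
  have hmem : ∀ z₁ ∈ Metric.ball p.1 R, ∀ z₂ ∈ Metric.ball p.2 R, (z₁, z₂) ∈ Metric.ball p R := by
    intro z₁ h₁ z₂ h₂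
    rw [← ball_prod_same]
    exact ⟨h₁, h₂⟩
  have hs : ∀ c : ℂ, Metric.closedBall c (R / 2) ⊆ Metric.ball c R := fun c =>
    Metric.closedBall_subset_ball (by linarith)
  refine analyticAt_of_separately hr ?_ ?_ ?_
  · refine continuousOn_tsum (fun n q hq => ?_) hM (fun n q hq => (hball q (hsub hq) n).2)
    exact (hball q (hsub hq) n).1.continuousAt.continuousWithinAt
  · intro z₂ hz₂
    refine (Complex.differentiableOn_tsum_of_summable_norm (F := fun n z => F n (z, z₂)) hM
      (fun n z hz => ?_) Metric.isOpen_ball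
      (fun n z hz => (hball _ (hmem z hz z₂ (hs _ hz₂)) n).2)).mono (hs _)
    have h := (hball _ (hmem z hz z₂ (hs _ hz₂)) n).1.differentiableAt
    exact (h.comp z (f := fun z => (z, z₂)) (by fun_prop)).differentiableWithinAt
  · intro z₁ hz₁
    refine (Complex.differentiableOn_tsum_of_summable_norm (F := fun n z => F n (z₁, z)) hM
      (fun n z hz => ?_) Metric.isOpen_ball
      (fun n z hz => (hball _ (hmem z₁ (hs _ hz₁) z hz) n).2)).mono (hs _)
    have h := (hball _ (hmem z₁ (hs _ hz₁) z hz) n).1.differentiableAt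
    exact (h.comp z (f := fun z => (z₁, z)) (by fun_prop)).differentiableWithinAt

/-! ### Taylor's formula for complex powers -/

/-- The generalized binomial coefficient `c (c - 1) ⋯ (c - k + 1) / k!`. -/
def binomCoeff (k : ℕ) (c : ℂ) : ℂ := (∏ j ∈ Finset.range k, (c - j)) / (k.factorial : ℂ)

lemma binomCoeff_zero (c : ℂ) : binomCoeff 0 c = 1 := by simp [binomCoeff]

lemma succ_mul_binomCoeff_succ (k : ℕ) (c : ℂ) :
    ((k : ℂ) + 1) * binomCoeff (k + 1) c = c * binomCoeff k (c - 1) := by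
  have h1 : ((k : ℂ) + 1) ≠ 0 := Nat.cast_add_one_ne_zero k
  have h2 : (k.factorial : ℂ) ≠ 0 := Nat.cast_ne_zero.2 k.factorial_ne_zero
  rw [binomCoeff, binomCoeff, Finset.prod_range_succ', Nat.factorial_succ]
  have : ∏ j ∈ Finset.range k, (c - ((j + 1 : ℕ) : ℂ)) = ∏ j ∈ Finset.range k, (c - 1 - j) :=
    Finset.prod_congr rfl fun j _ => by push_cast; ring
  rw [this]
  push_cast
  field_simp
  ring

/-- Taylor's formula for `(1 + y) ^ c` with a remainder that is uniform in the exponent. -/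
lemma one_add_cpow_taylor (m : ℕ) (B : ℝ) : ∃ C : ℝ, 0 ≤ C ∧ ∀ c : ℂ, ‖c‖ ≤ B → ∀ y : ℂ,
    ‖y‖ ≤ 1 / 2 →
    ‖(1 + y) ^ c - ∑ k ∈ Finset.range m, binomCoeff k c * y ^ k‖ ≤ C * ‖y‖ ^ m := by
  induction m generalizing B with
  | zero =>
    refine ⟨Real.exp (B * 1), (Real.exp_pos _).le, fun c hc y hy => ?_⟩
    have hne : 1 + y ≠ 0 := by
      intro h
      rw [eq_neg_of_add_eq_zero_right h, norm_neg, norm_one] at hy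
      norm_num at hy
    simp only [Finset.range_zero, Finset.sum_empty, sub_zero, pow_zero, mul_one]
    rw [Complex.cpow_def_of_ne_zero hne]
    refine (Complex.norm_exp_le_exp_norm _).trans (Real.exp_le_exp.2 ?_)
    rw [norm_mul, mul_comm]
    have h1 := Complex.norm_log_one_add_half_le_self hy
    have h2 : ‖Complex.log (1 + y)‖ ≤ 1 := by linarith
    have := mul_le_mul hc h2 (norm_nonneg _) ((norm_nonneg c).trans hc)
    linarith
  | succ m ih =>
    obtain ⟨C, hC, h⟩ := ih (B + 1)
    refine ⟨|B| * C, by positivity, fun c hc y hy => ?_⟩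
    have hcb : ‖c‖ ≤ |B| := hc.trans (le_abs_self B)
    have hc1 : ‖c - 1‖ ≤ B + 1 := (norm_sub_le _ _).trans (by simpa using hc)
    set g : ℂ → ℂ := fun v => (1 + v) ^ c - ∑ k ∈ Finset.range (m + 1), binomCoeff k c * v ^ k
      with hg
    -- The derivative of the remainder of order `m + 1` for the exponent `c` is `c` times the
    -- remainder of order `m` for the exponent `c - 1`.
    have hder : ∀ v ∈ Metric.closedBall (0 : ℂ) ‖y‖, HasDerivWithinAt g
        (c * ((1 + v) ^ (c - 1) - ∑ k ∈ Finset.range m, binomCoeff k (c - 1) * v ^ k))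
        (Metric.closedBall (0 : ℂ) ‖y‖) v := by
      intro v hv
      have hv' : ‖v‖ ≤ 1 / 2 := (mem_closedBall_zero_iff.1 hv).trans hy
      have hre : |v.re| ≤ 1 / 2 := (Complex.abs_re_le_norm v).trans hv'
      have hslit : 1 + v ∈ Complex.slitPlane := by
        left
        simp only [Complex.add_re, Complex.one_re]
        linarith [(abs_le.1 hre).1]
      have h1 : HasDerivAt (fun v : ℂ => (1 + v) ^ c) (c * (1 + v) ^ (c - 1) * 1) v :=
        ((hasDerivAt_id v).const_add 1).cpow_const hslit
      have h2 : HasDerivAt (fun v : ℂ => ∑ k ∈ Finset.range (m + 1), binomCoeff k c * v ^ k)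
          (∑ k ∈ Finset.range (m + 1), binomCoeff k c * ((k : ℂ) * v ^ (k - 1))) v :=
        HasDerivAt.fun_sum fun k _ => (hasDerivAt_pow k v).const_mul _
      refine ((h1.sub h2).congr_deriv ?_).hasDerivWithinAt
      rw [Finset.sum_range_succ', mul_sub, Finset.mul_sum]
      simp only [Nat.cast_zero, zero_mul, mul_zero, add_zero, mul_one, Nat.add_sub_cancel]
      congr 1
      refine Finset.sum_congr rfl fun k _ => ?_
      rw [← mul_assoc c, ← succ_mul_binomCoeff_succ]
      push_cast
      ring
    have hbound : ∀ v ∈ Metric.closedBall (0 : ℂ) ‖y‖,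
        ‖c * ((1 + v) ^ (c - 1) - ∑ k ∈ Finset.range m, binomCoeff k (c - 1) * v ^ k)‖ ≤
          |B| * (C * ‖y‖ ^ m) := by
      intro v hv
      have hv' : ‖v‖ ≤ ‖y‖ := mem_closedBall_zero_iff.1 hv
      rw [norm_mul]
      refine mul_le_mul hcb ((h (c - 1) hc1 v (hv'.trans hy)).trans ?_) (norm_nonneg _)
        (abs_nonneg B)
      gcongr
    have key := (convex_closedBall (0 : ℂ) ‖y‖).norm_image_sub_le_of_norm_hasDerivWithin_le
      hder hbound (Metric.mem_closedBall_self (norm_nonneg y))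
      (mem_closedBall_zero_iff.2 le_rfl)
    have hg0 : g 0 = 0 := by
      simp only [hg]
      rw [Finset.sum_range_succ']
      simp [binomCoeff_zero]
    rw [hg0, sub_zero, sub_zero] at key
    calc _ ≤ _ := key
      _ = _ := by ring

lemma norm_cpow_le_of_norm_le {u c : ℂ} {B : ℝ} (hc : ‖c‖ ≤ B) :
    ‖u ^ c‖ ≤ Real.exp (Real.pi * B) * ‖u‖ ^ c.re := by
  refine (Complex.norm_cpow_le u c).trans ?_
  rw [div_eq_mul_inv, ← Real.exp_neg, mul_comm]
  gcongr
  have h1 : |Complex.arg u * c.im| ≤ Real.pi * B := by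
    rw [abs_mul]
    exact mul_le_mul (Complex.abs_arg_le_pi u) ((Complex.abs_im_le_norm c).trans hc)
      (abs_nonneg _) Real.pi_pos.le
  exact (neg_le_abs _).trans h1

/-- Multiplicativity of principal powers in the right half-plane. -/
lemma mul_cpow_of_re_pos {u v : ℂ} (hu : 0 < u.re) (hv : 0 < v.re) (c : ℂ) :
    (u * v) ^ c = u ^ c * v ^ c := by
  have hu0 : u ≠ 0 := by rintro rfl; simp at hu
  have hv0 : v ≠ 0 := by rintro rfl; simp at hv
  have h1 := abs_lt.1 (Complex.abs_arg_lt_pi_div_two_iff.2 (Or.inl hu))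
  have h2 := abs_lt.1 (Complex.abs_arg_lt_pi_div_two_iff.2 (Or.inl hv))
  rw [Complex.cpow_def_of_ne_zero (mul_ne_zero hu0 hv0), Complex.cpow_def_of_ne_zero hu0,
    Complex.cpow_def_of_ne_zero hv0, Complex.log_mul hu0 hv0 ⟨by linarith, by linarith⟩,
    add_mul, Complex.exp_add]

/-- Taylor's formula for `(u + h) ^ c` in the right half-plane, for steps that are small relative
to `u`. -/
lemma add_cpow_taylor (m : ℕ) (B : ℝ) : ∃ C : ℝ, 0 ≤ C ∧ ∀ c : ℂ, ‖c‖ ≤ B → ∀ u h : ℂ,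
    0 < u.re → 2 * ‖h‖ ≤ ‖u‖ →
    ‖(u + h) ^ c - ∑ k ∈ Finset.range m, binomCoeff k c * h ^ k * (u ^ c / u ^ k)‖ ≤
      C * ‖h‖ ^ m * ‖u‖ ^ (c.re - m) := by
  obtain ⟨C, hC, key⟩ := one_add_cpow_taylor m B
  refine ⟨Real.exp (Real.pi * B) * C, by positivity, fun c hc u h hu hh => ?_⟩
  have hu0 : u ≠ 0 := by rintro rfl; simp at hu
  have hun : 0 < ‖u‖ := norm_pos_iff.2 hu0
  have hy : ‖h / u‖ ≤ 1 / 2 := by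
    rw [norm_div, div_le_iff₀ hun]
    linarith
  have hre : |(h / u).re| ≤ 1 / 2 := (Complex.abs_re_le_norm _).trans hy
  have hpos : 0 < (1 + h / u).re := by
    simp only [Complex.add_re, Complex.one_re]
    linarith [(abs_le.1 hre).1]
  have e1 : u + h = u * (1 + h / u) := by field_simp
  have e2 : ∑ k ∈ Finset.range m, binomCoeff k c * h ^ k * (u ^ c / u ^ k) =
      u ^ c * ∑ k ∈ Finset.range m, binomCoeff k c * (h / u) ^ k := by
    rw [Finset.mul_sum]
    refine Finset.sum_congr rfl fun k _ => ?_
    rw [div_pow]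
    ring
  rw [e2, e1, mul_cpow_of_re_pos hu hpos, ← mul_sub, norm_mul]
  calc ‖u ^ c‖ * _ ≤ (Real.exp (Real.pi * B) * ‖u‖ ^ c.re) * (C * ‖h / u‖ ^ m) :=
        mul_le_mul (norm_cpow_le_of_norm_le hc) (key c hc _ hy) (norm_nonneg _) (by positivity)
    _ = _ := by
        rw [Real.rpow_sub hun, Real.rpow_natCast, norm_div, div_pow]
        ring

/-! ### Convergence over the lattice points -/

lemma summable_nat_rpow {p δ : ℝ} (hp : 1 < p) (hδ : 0 < δ) :
    Summable fun n : ℕ => (δ * ((n : ℝ) + 1)) ^ (-p) := by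
  have h := ((summable_nat_add_iff 1).2 (Real.summable_nat_rpow.2 (by linarith : -p < -1))).mul_left
    (δ ^ (-p))
  refine h.congr fun n => ?_
  rw [Real.mul_rpow hδ.le (by positivity)]
  push_cast
  rfl

lemma summable_lattice_rpow {p δ : ℝ} (hp : 2 < p) (hδ : 0 < δ) :
    Summable fun n : ℕ × ℕ => (δ * ((n.1 : ℝ) + n.2 + 1)) ^ (-p) := by
  have h1 : Summable fun n : ℕ => ((1 : ℝ) * ((n : ℝ) + 1)) ^ (-(p / 2)) :=
    summable_nat_rpow (by linarith) one_pos
  have h2 := (h1.mul_of_nonneg h1 (fun n => by positivity) (fun n => by positivity)).mul_left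
    (δ ^ (-p))
  refine Summable.of_nonneg_of_le (fun n => by positivity) (fun n => ?_) h2
  rw [Real.mul_rpow hδ.le (by positivity)]
  gcongr
  rw [one_mul, one_mul, ← Real.mul_rpow (by positivity) (by positivity)]
  have e : -p = 2 * -(p / 2) := by ring
  rw [e, Real.rpow_mul (by positivity)]
  refine Real.rpow_le_rpow_of_nonpos (by positivity) ?_ (by linarith)
  rw [Real.rpow_two]
  nlinarith [mul_nonneg n.1.cast_nonneg (α := ℝ) n.2.cast_nonneg,
    sq_nonneg (n.1 : ℝ), sq_nonneg (n.2 : ℝ), n.1.cast_nonneg (α := ℝ), n.2.cast_nonneg (α := ℝ)]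

/-- The remainder of order `m` in Taylor's formula for `(u + h) ^ c`. -/
def cpowRemainder (m : ℕ) (c u h : ℂ) : ℂ :=
  (u + h) ^ c - ∑ k ∈ Finset.range m, binomCoeff k c * h ^ k * (u ^ c / u ^ k)

/-- A part of the domain of continuation on which all bounds are uniform. -/
def zetaBox (σ ε B : ℝ) : Set ℂ := {s | σ < s.re ∧ ‖s‖ < B ∧ ε < ‖1 - s‖ ∧ ε < ‖2 - s‖}

lemma isOpen_zetaBox (σ ε B : ℝ) : IsOpen (zetaBox σ ε B) := by
  have h : ∀ c : ℂ, IsOpen {s : ℂ | ε < ‖c - s‖} := fun c =>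
    isOpen_lt continuous_const (by fun_prop)
  exact (isOpen_lt continuous_const Complex.continuous_re).inter
    ((isOpen_lt continuous_norm continuous_const).inter ((h 1).inter (h 2)))

/-- The remainder of `(u + h) ^ (j - s)` of order `j + i` is `O(|u| ^ (-σ - i))`, uniformly. -/
lemma cpowRemainder_bound (m j i : ℕ) (hm : m = j + i) (σ B M : ℝ) : ∃ C : ℝ, 0 ≤ C ∧ ∀ s : ℂ,
    σ < s.re → ‖s‖ ≤ B → ∀ u h : ℂ, 0 < u.re → 1 ≤ ‖u‖ → 2 * ‖h‖ ≤ ‖u‖ → ‖h‖ ≤ M →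
    ‖cpowRemainder m (j - s) u h‖ ≤ C * ‖u‖ ^ (-(σ + i)) := by
  obtain ⟨C, hC, key⟩ := add_cpow_taylor m (j + B)
  refine ⟨C * |M| ^ m, by positivity, fun s hs hsB u h hu hu1 hh hM => ?_⟩
  refine (key (j - s) ((norm_sub_le _ _).trans (by simpa using hsB)) u h hu hh).trans ?_
  have : ‖h‖ ≤ |M| := hM.trans (le_abs_self M)
  gcongr
  simp only [Complex.sub_re, Complex.natCast_re, hm]
  push_cast
  linarith

/-! ### Corrected summands -/

/-- The Euler–Maclaurin antidifference of `u ^ (-s)` with step `a`, up to lower order: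
`h(u) - h(u + a) = u ^ (-s) + O(u ^ (-s - 2))`. -/
def antidiff1 (a u s : ℂ) : ℂ := -(u ^ (1 - s) / (a * (1 - s))) + u ^ (-s) / 2

/-- The error `u ^ (-s) - (h(u) - h(u + a))` of the antidifference. -/
def error1 (a u s : ℂ) : ℂ := u ^ (-s) - antidiff1 a u s + antidiff1 a (u + a) s

/-- The Euler–Maclaurin antidifference of `u ^ (-s)` with the two steps `a` and `b`, up to lower
order: the second difference of `H` is `u ^ (-s) + O(u ^ (-s - 3))`. The coefficients are those of
`a b D ^ 2 / ((exp (a D) - 1) (exp (b D) - 1))`. -/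
def antidiff2 (a b u s : ℂ) : ℂ :=
  u ^ (2 - s) / (a * b * ((1 - s) * (2 - s))) - (a + b) / (2 * a * b) * (u ^ (1 - s) / (1 - s)) +
    (a / (12 * b) + b / (12 * a) + 1 / 4) * u ^ (-s)

/-- The error of the antidifference with two steps. -/
def error2 (a b u s : ℂ) : ℂ :=
  u ^ (-s) - (antidiff2 a b u s - antidiff2 a b (u + a) s - antidiff2 a b (u + b) s +
    antidiff2 a b (u + a + b) s)

lemma error1_eq {a u s : ℂ} (ha : a ≠ 0) (hu : u ≠ 0) (hs : 1 - s ≠ 0) :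
    error1 a u s = -(1 / (a * (1 - s)) * cpowRemainder 3 ((1 : ℕ) - s) u a) +
      1 / 2 * cpowRemainder 2 ((0 : ℕ) - s) u a := by
  have e1 : u ^ (1 - s) = u * u ^ (-s) := by
    rw [sub_eq_add_neg, Complex.cpow_add _ _ hu, Complex.cpow_one]
  simp only [error1, antidiff1, cpowRemainder, Nat.cast_one, Nat.cast_zero, zero_sub]
  simp only [Finset.sum_range_succ, Finset.sum_range_zero, binomCoeff, Finset.prod_range_succ,
    Finset.prod_range_zero, Nat.factorial, e1]
  push_cast
  generalize (u + a) ^ (1 - s) = A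
  generalize (u + a) ^ (-s) = A'
  generalize u ^ (-s) = p
  field_simp
  ring

lemma error2_eq {a b u s : ℂ} (ha : a ≠ 0) (hb : b ≠ 0) (hu : u ≠ 0) (hs : 1 - s ≠ 0)
    (hs' : 2 - s ≠ 0) :
    error2 a b u s = 1 / (a * b * ((1 - s) * (2 - s))) *
        (cpowRemainder 5 ((2 : ℕ) - s) u a + cpowRemainder 5 ((2 : ℕ) - s) u b -
          cpowRemainder 5 ((2 : ℕ) - s) u (a + b)) -
      (a + b) / (2 * a * b * (1 - s)) *
        (cpowRemainder 4 ((1 : ℕ) - s) u a + cpowRemainder 4 ((1 : ℕ) - s) u b -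
          cpowRemainder 4 ((1 : ℕ) - s) u (a + b)) +
      (a / (12 * b) + b / (12 * a) + 1 / 4) *
        (cpowRemainder 3 ((0 : ℕ) - s) u a + cpowRemainder 3 ((0 : ℕ) - s) u b -
          cpowRemainder 3 ((0 : ℕ) - s) u (a + b)) := by
  have e1 : u ^ (1 - s) = u * u ^ (-s) := by
    rw [sub_eq_add_neg, Complex.cpow_add _ _ hu, Complex.cpow_one]
  have e2 : u ^ (2 - s) = u ^ 2 * u ^ (-s) := by
    rw [sub_eq_add_neg, Complex.cpow_add _ _ hu, Complex.cpow_ofNat]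
  simp only [error2, antidiff2, cpowRemainder, Nat.cast_one, Nat.cast_zero, zero_sub,
    Nat.cast_ofNat]
  simp only [Finset.sum_range_succ, Finset.sum_range_zero, binomCoeff, Finset.prod_range_succ,
    Finset.prod_range_zero, Nat.factorial, e1, e2, ← add_assoc]
  push_cast
  generalize (u + a) ^ (2 - s) = A2
  generalize (u + a) ^ (1 - s) = A1
  generalize (u + a) ^ (-s) = A0
  generalize (u + b) ^ (2 - s) = B2
  generalize (u + b) ^ (1 - s) = B1
  generalize (u + b) ^ (-s) = B0
  generalize (u + a + b) ^ (2 - s) = C2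
  generalize (u + a + b) ^ (1 - s) = C1
  generalize (u + a + b) ^ (-s) = C0
  generalize u ^ (-s) = p
  field_simp
  ring

lemma error1_bound {σ ε B δ M : ℝ} (hε : 0 < ε) (hδ : 0 < δ) : ∃ C : ℝ, 0 ≤ C ∧
    ∀ a : ℂ, δ ≤ ‖a‖ → ‖a‖ ≤ M → ∀ s ∈ zetaBox σ ε B, ∀ u : ℂ, 0 < u.re → 1 ≤ ‖u‖ →
    2 * M ≤ ‖u‖ → ‖error1 a u s‖ ≤ C * ‖u‖ ^ (-(σ + 2)) := by
  obtain ⟨C₁, hC₁, k₁⟩ := cpowRemainder_bound 3 1 2 rfl σ B M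
  obtain ⟨C₂, hC₂, k₂⟩ := cpowRemainder_bound 2 0 2 rfl σ B M
  refine ⟨1 / (δ * ε) * C₁ + 1 / 2 * C₂, by positivity, ?_⟩
  rintro a ha haM s ⟨hs, hsB, hs1, -⟩ u hu hu1 huM
  have hu0 : u ≠ 0 := by rintro rfl; simp at hu
  have ha0 : a ≠ 0 := norm_pos_iff.1 (hδ.trans_le ha)
  have hs0 : 1 - s ≠ 0 := norm_pos_iff.1 (hε.trans hs1)
  have b₁ := k₁ s hs hsB.le u a hu hu1 (by linarith) haM
  have b₂ := k₂ s hs hsB.le u a hu hu1 (by linarith) haM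
  have hq : ‖1 / (a * (1 - s))‖ ≤ 1 / (δ * ε) := by
    rw [norm_div, norm_one, norm_mul]
    gcongr
  rw [error1_eq ha0 hu0 hs0]
  refine (norm_add_le _ _).trans ?_
  rw [norm_neg, norm_mul, norm_mul, add_mul, mul_assoc, mul_assoc]
  have hhalf : ‖(1 / 2 : ℂ)‖ = 1 / 2 := by simp
  rw [hhalf]
  refine add_le_add (mul_le_mul hq (by exact_mod_cast b₁) (norm_nonneg _) (by positivity))
    (mul_le_mul le_rfl (by exact_mod_cast b₂) (norm_nonneg _) (by positivity))

lemma error2_bound {σ ε B δ M : ℝ} (hε : 0 < ε) (hδ : 0 < δ) : ∃ C : ℝ, 0 ≤ C ∧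
    ∀ a b : ℂ, δ ≤ ‖a‖ → ‖a‖ ≤ M → δ ≤ ‖b‖ → ‖b‖ ≤ M → ∀ s ∈ zetaBox σ ε B, ∀ u : ℂ, 0 < u.re →
    1 ≤ ‖u‖ → 4 * M ≤ ‖u‖ → ‖error2 a b u s‖ ≤ C * ‖u‖ ^ (-(σ + 3)) := by
  obtain ⟨C₁, hC₁, k₁⟩ := cpowRemainder_bound 5 2 3 rfl σ B (2 * M)
  obtain ⟨C₂, hC₂, k₂⟩ := cpowRemainder_bound 4 1 3 rfl σ B (2 * M)
  obtain ⟨C₃, hC₃, k₃⟩ := cpowRemainder_bound 3 0 3 rfl σ B (2 * M)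
  refine ⟨1 / (δ * δ * (ε * ε)) * (3 * C₁) + (|M| + |M|) / (2 * δ * δ * ε) * (3 * C₂) +
    (|M| / (12 * δ) + |M| / (12 * δ) + 1 / 4) * (3 * C₃), by positivity, ?_⟩
  rintro a b ha haM hb hbM s ⟨hs, hsB, hs1, hs2⟩ u hu hu1 huM
  have hu0 : u ≠ 0 := by rintro rfl; simp at hu
  have ha0 : a ≠ 0 := norm_pos_iff.1 (hδ.trans_le ha)
  have hb0 : b ≠ 0 := norm_pos_iff.1 (hδ.trans_le hb)
  have hs0 : 1 - s ≠ 0 := norm_pos_iff.1 (hε.trans hs1)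
  have hs0' : 2 - s ≠ 0 := norm_pos_iff.1 (hε.trans hs2)
  have hM0 : 0 ≤ M := (norm_nonneg a).trans haM
  have haM' : ‖a‖ ≤ |M| := haM.trans (le_abs_self M)
  have hbM' : ‖b‖ ≤ |M| := hbM.trans (le_abs_self M)
  have hab : ‖a + b‖ ≤ 2 * M := (norm_add_le a b).trans (by linarith)
  have three : ∀ {f : ℂ → ℂ} {K : ℝ}, (∀ h : ℂ, 2 * ‖h‖ ≤ ‖u‖ → ‖h‖ ≤ 2 * M → ‖f h‖ ≤ K) →
      ‖f a + f b - f (a + b)‖ ≤ 3 * K := by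
    intro f K hf
    have f1 := hf a (by linarith) (by linarith)
    have f2 := hf b (by linarith) (by linarith)
    have f3 := hf (a + b) (by linarith) hab
    calc _ ≤ ‖f a‖ + ‖f b‖ + ‖f (a + b)‖ :=
          (norm_sub_le _ _).trans (by gcongr; exact norm_add_le _ _)
      _ ≤ _ := by linarith
  have b₁ := three (fun h => k₁ s hs hsB.le u h hu hu1)
  have b₂ := three (fun h => k₂ s hs hsB.le u h hu hu1)
  have b₃ := three (fun h => k₃ s hs hsB.le u h hu hu1)
  have q₁ : ‖1 / (a * b * ((1 - s) * (2 - s)))‖ ≤ 1 / (δ * δ * (ε * ε)) := by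
    rw [norm_div, norm_one, norm_mul, norm_mul, norm_mul]
    gcongr
  have q₂ : ‖(a + b) / (2 * a * b * (1 - s))‖ ≤ (|M| + |M|) / (2 * δ * δ * ε) := by
    rw [norm_div, norm_mul, norm_mul, norm_mul, Complex.norm_ofNat]
    gcongr
    exact (norm_add_le a b).trans (add_le_add haM' hbM')
  have q₃ : ‖a / (12 * b) + b / (12 * a) + 1 / 4‖ ≤ |M| / (12 * δ) + |M| / (12 * δ) + 1 / 4 := by
    refine (norm_add₃_le).trans ?_
    rw [norm_div, norm_div, norm_mul, norm_mul, Complex.norm_ofNat]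
    have h4 : ‖(1 / 4 : ℂ)‖ = 1 / 4 := by simp
    rw [h4]
    gcongr
  rw [error2_eq ha0 hb0 hu0 hs0 hs0']
  refine (norm_add_le _ _).trans ?_
  refine (add_le_add_left (norm_sub_le _ _) _).trans ?_
  rw [norm_mul, norm_mul, norm_mul, add_mul, add_mul]
  have aux : ∀ {q Q t K w : ℝ}, 0 ≤ t → 0 ≤ Q → q ≤ Q → t ≤ 3 * (K * w) →
      q * t ≤ Q * (3 * K) * w := by
    intro q Q t K w ht hQ hq htK
    rw [mul_assoc, mul_assoc 3]
    exact mul_le_mul hq htK ht hQ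
  exact add_le_add (add_le_add
    (aux (norm_nonneg _) (by positivity) q₁ (by exact_mod_cast b₁))
    (aux (norm_nonneg _) (by positivity) q₂ (by exact_mod_cast b₂)))
    (aux (norm_nonneg _) (by positivity) q₃ (by exact_mod_cast b₃))

/-! ### Analytic continuation of zeta series -/

/-- The region `Re s > -1`, `s ≠ 1, 2`. -/
def zetaDomain : Set ℂ := {s | -1 < s.re} \ {1, 2}

/-- `Z` continues the function `S`, given for `Re s > 2`, to the region `Re s > -1`, `s ≠ 1, 2`. -/
structure IsContinuation (S Z : ℂ → ℂ) : Prop where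
  analytic : AnalyticOnNhd ℂ Z zetaDomain
  eq : ∀ s : ℂ, 2 < s.re → Z s = S s

lemma isOpen_zetaDomain : IsOpen zetaDomain :=
  (isOpen_lt continuous_const Complex.continuous_re).sdiff (Set.toFinite _).isClosed

lemma ball_subset_zetaDomain : Metric.ball (0 : ℂ) 1 ⊆ zetaDomain := by
  intro s hs
  have h : ‖s‖ < 1 := mem_ball_zero_iff.1 hs
  refine ⟨?_, ?_⟩
  · have := (abs_le.1 (Complex.abs_re_le_norm s)).1
    simp only [Set.mem_ofPred_eq]
    linarith
  · rintro (rfl | rfl) <;> norm_num at h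

lemma zero_mem_zetaDomain : (0 : ℂ) ∈ zetaDomain :=
  ball_subset_zetaDomain (Metric.mem_ball_self one_pos)

lemma ne_of_mem_zetaDomain {s : ℂ} (hs : s ∈ zetaDomain) : 1 - s ≠ 0 ∧ 2 - s ≠ 0 := by
  have h := hs.2
  simp only [Set.mem_insert_iff, Set.mem_singleton_iff, not_or] at h
  exact ⟨fun e => h.1 (sub_eq_zero.1 e).symm, fun e => h.2 (sub_eq_zero.1 e).symm⟩

lemma exists_mem_zetaBox {s : ℂ} (hs : s ∈ zetaDomain) :
    ∃ σ ε B : ℝ, -1 < σ ∧ 0 < ε ∧ s ∈ zetaBox σ ε B := by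
  obtain ⟨h1, h2⟩ := ne_of_mem_zetaDomain hs
  have hre : -1 < s.re := hs.1
  obtain ⟨σ, hσ, hσ'⟩ := exists_between hre
  obtain ⟨ε, hε, hε'⟩ := exists_between (lt_min (norm_pos_iff.2 h1) (norm_pos_iff.2 h2))
  exact ⟨σ, ε, ‖s‖ + 1, hσ, hε, hσ', by linarith, (lt_min_iff.1 hε').1, (lt_min_iff.1 hε').2⟩

lemma zetaBox_subset {σ ε B : ℝ} (hσ : -1 < σ) (hε : 0 < ε) : zetaBox σ ε B ⊆ zetaDomain := by
  rintro s ⟨h, -, h1, h2⟩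
  refine ⟨hσ.trans h, ?_⟩
  rintro (rfl | rfl)
  · rw [sub_self, norm_zero] at h1
    linarith
  · rw [sub_self, norm_zero] at h2
    linarith

/-- Two continuations agree near `0`: the identity theorem is applied on the convex sets
`{Re s > -1, Im s > 0}` and `{-1 < Re s < 1}`. -/
lemma IsContinuation.eventuallyEq {S Z Z' : ℂ → ℂ} (h : IsContinuation S Z)
    (h' : IsContinuation S Z') : Z =ᶠ[𝓝 0] Z' := by
  have hc1 : Convex ℝ ({s : ℂ | -1 < s.re} ∩ {s : ℂ | 0 < s.im}) :=
    (convex_halfSpace_re_gt _).inter (convex_halfSpace_im_gt _)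
  have hc2 : Convex ℝ ({s : ℂ | -1 < s.re} ∩ {s : ℂ | s.re < 1}) :=
    (convex_halfSpace_re_gt _).inter (convex_halfSpace_re_lt _)
  have hs1 : ({s : ℂ | -1 < s.re} ∩ {s : ℂ | 0 < s.im}) ⊆ zetaDomain := by
    rintro s ⟨h1, h2⟩
    refine ⟨h1, ?_⟩
    rintro (rfl | rfl) <;> simp at h2
  have hs2 : ({s : ℂ | -1 < s.re} ∩ {s : ℂ | s.re < 1}) ⊆ zetaDomain := by
    rintro s ⟨h1, h2⟩
    refine ⟨h1, ?_⟩
    rintro (rfl | rfl) <;> norm_num at h2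
  have e1 := (h.analytic.mono hs1).eqOn_of_preconnected_of_eventuallyEq (h'.analytic.mono hs1)
    hc1.isPreconnected (z₀ := 3 + Complex.I) (by constructor <;> simp; norm_num) (by
      filter_upwards [(isOpen_lt continuous_const Complex.continuous_re).mem_nhds
        (show (2 : ℝ) < (3 + Complex.I).re by simp; norm_num)] with s hs
      rw [h.eq s hs, h'.eq s hs])
  have e2 := (h.analytic.mono hs2).eqOn_of_preconnected_of_eventuallyEq (h'.analytic.mono hs2)
    hc2.isPreconnected (z₀ := Complex.I) (by constructor <;> simp) (by
      filter_upwards [((isOpen_lt continuous_const Complex.continuous_re).inter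
        (isOpen_lt continuous_const Complex.continuous_im)).mem_nhds
        (show Complex.I ∈ {s : ℂ | -1 < s.re} ∩ {s : ℂ | 0 < s.im} by constructor <;> simp)]
        with s hs
      exact e1 hs)
  filter_upwards [((isOpen_lt continuous_const Complex.continuous_re).inter
      (isOpen_lt Complex.continuous_re continuous_const)).mem_nhds
      (show (0 : ℂ) ∈ {s : ℂ | -1 < s.re} ∩ {s : ℂ | s.re < 1} by constructor <;> simp)] with s hs
  exact e2 hs

lemma IsContinuation.add {S S' Z Z' : ℂ → ℂ} (h : IsContinuation S Z)
    (h' : IsContinuation S' Z') : IsContinuation (S + S') (Z + Z') :=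
  ⟨h.analytic.add h'.analytic, fun s hs => by simp [h.eq s hs, h'.eq s hs]⟩

lemma analyticOnNhd_tsum {ι : Type*} {F : ι → ℂ → ℂ}
    (hd : ∀ n, DifferentiableOn ℂ (F n) zetaDomain)
    (hb : ∀ σ ε B : ℝ, -1 < σ → 0 < ε → ∃ M : ι → ℝ, Summable M ∧
      ∀ n, ∀ s ∈ zetaBox σ ε B, ‖F n s‖ ≤ M n) :
    AnalyticOnNhd ℂ (fun s => ∑' n, F n s) zetaDomain := by
  intro s hs
  obtain ⟨σ, ε, B, hσ, hε, hbox⟩ := exists_mem_zetaBox hs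
  obtain ⟨M, hM, hFM⟩ := hb σ ε B hσ hε
  have h := Complex.differentiableOn_tsum_of_summable_norm hM
    (fun n => (hd n).mono (zetaBox_subset hσ hε)) (isOpen_zetaBox σ ε B) hFM
  exact h.analyticAt ((isOpen_zetaBox σ ε B).mem_nhds hbox)

lemma hasSum_deriv_zero {ι : Type*} {F : ι → ℂ → ℂ}
    (hd : ∀ n, DifferentiableOn ℂ (F n) zetaDomain)
    (hb : ∀ σ ε B : ℝ, -1 < σ → 0 < ε → ∃ M : ι → ℝ, Summable M ∧
      ∀ n, ∀ s ∈ zetaBox σ ε B, ‖F n s‖ ≤ M n) :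
    HasSum (fun n => deriv (F n) 0) (deriv (fun s => ∑' n, F n s) 0) := by
  obtain ⟨σ, ε, B, hσ, hε, hbox⟩ := exists_mem_zetaBox zero_mem_zetaDomain
  obtain ⟨M, hM, hFM⟩ := hb σ ε B hσ hε
  exact Complex.hasSum_deriv_of_summable_norm hM
    (fun n => (hd n).mono (zetaBox_subset hσ hε)) (isOpen_zetaBox σ ε B) hFM hbox

/-! ### Telescoping -/

lemma tendsto_norm_add_natCast_mul (x : ℂ) {b : ℂ} (hb : b ≠ 0) :
    Tendsto (fun n : ℕ => ‖x + n * b‖) atTop atTop := by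
  have h : Tendsto (fun n : ℕ => (n : ℝ) * ‖b‖ - ‖x‖) atTop atTop :=
    tendsto_atTop_add_const_right _ _
      (tendsto_natCast_atTop_atTop.atTop_mul_const (norm_pos_iff.2 hb))
  refine tendsto_atTop_mono (fun n => ?_) h
  have h1 := norm_sub_le (x + n * b) x
  rw [add_sub_cancel_left, norm_mul, Complex.norm_natCast] at h1
  linarith

lemma tendsto_cpow_zero {u : ℕ → ℂ} (hu : Tendsto (fun n => ‖u n‖) atTop atTop) {c : ℂ}
    (hc : c.re < 0) : Tendsto (fun n => u n ^ c) atTop (𝓝 0) := by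
  refine squeeze_zero_norm (fun n => norm_cpow_le_of_norm_le (le_refl ‖c‖)) ?_
  have h := (tendsto_rpow_neg_atTop (show 0 < -c.re by linarith)).comp hu
  simpa using h.const_mul (Real.exp (Real.pi * ‖c‖))

lemma tsum_sub_succ {φ : ℕ → ℂ} (hs : Summable fun n => φ n - φ (n + 1))
    (h0 : Tendsto φ atTop (𝓝 0)) : ∑' n, (φ n - φ (n + 1)) = φ 0 := by
  refine tendsto_nhds_unique hs.hasSum.tendsto_sum_nat ?_
  simp_rw [Finset.sum_range_sub']
  simpa using h0.const_sub (φ 0)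

/-- A summable second difference of a double sequence that vanishes at infinity along the second
index, and along the first one on the edge, sums to the corner value. -/
lemma tsum_second_difference {φ : ℕ → ℕ → ℂ}
    (hs : Summable fun n : ℕ × ℕ => φ n.1 n.2 - φ (n.1 + 1) n.2 - φ n.1 (n.2 + 1) +
      φ (n.1 + 1) (n.2 + 1))
    (h1 : ∀ m, Tendsto (φ m) atTop (𝓝 0)) (h2 : Tendsto (fun m => φ m 0) atTop (𝓝 0)) :
    ∑' n : ℕ × ℕ, (φ n.1 n.2 - φ (n.1 + 1) n.2 - φ n.1 (n.2 + 1) + φ (n.1 + 1) (n.2 + 1)) =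
      φ 0 0 := by
  have hin : ∀ m, ∑' n : ℕ, (φ m n - φ (m + 1) n - φ m (n + 1) + φ (m + 1) (n + 1)) =
      φ m 0 - φ (m + 1) 0 := by
    intro m
    have hsm : Summable fun n : ℕ => φ m n - φ (m + 1) n - φ m (n + 1) + φ (m + 1) (n + 1) := by
      simpa only [Function.comp_def] using hs.comp_injective (Prod.mk_right_injective m)
    have e : (fun n : ℕ => φ m n - φ (m + 1) n - φ m (n + 1) + φ (m + 1) (n + 1)) =
        fun n => (φ m n - φ (m + 1) n) - (φ m (n + 1) - φ (m + 1) (n + 1)) := by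
      ext n
      ring
    rw [e] at hsm ⊢
    exact tsum_sub_succ (φ := fun n => φ m n - φ (m + 1) n) hsm
      (by simpa using (h1 m).sub (h1 (m + 1)))
  have hout : Summable fun m => φ m 0 - φ (m + 1) 0 := by
    have := hs.prod
    simpa only [hin] using this
  rw [hs.tsum_prod]
  simp only [hin]
  exact tsum_sub_succ (φ := fun m => φ m 0) hout h2

lemma re_add_natCast_mul (x a : ℂ) (n : ℕ) : (x + n * a).re = x.re + n * a.re := by simp

/-! ### Differentiability in the exponent -/

lemma differentiableAt_const_cpow {u : ℂ} (hu : u ≠ 0) (c s : ℂ) :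
    DifferentiableAt ℂ (fun s => u ^ (c - s)) s :=
  ((differentiableAt_const c).sub differentiableAt_id).const_cpow (Or.inl hu)

lemma differentiableAt_const_cpow_neg {u : ℂ} (hu : u ≠ 0) (s : ℂ) :
    DifferentiableAt ℂ (fun s => u ^ (-s)) s :=
  differentiableAt_id.neg.const_cpow (Or.inl hu)

lemma differentiableOn_antidiff1 {a u : ℂ} (ha : a ≠ 0) (hu : u ≠ 0) :
    DifferentiableOn ℂ (antidiff1 a u) zetaDomain := by
  intro s hs
  obtain ⟨h1, -⟩ := ne_of_mem_zetaDomain hs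
  have := differentiableAt_const_cpow hu 1 s
  have := differentiableAt_const_cpow_neg hu s
  have : a * (1 - s) ≠ 0 := mul_ne_zero ha h1
  refine DifferentiableAt.differentiableWithinAt ?_
  unfold antidiff1
  fun_prop (disch := assumption)

lemma differentiableOn_antidiff2 {a b u : ℂ} (ha : a ≠ 0) (hb : b ≠ 0) (hu : u ≠ 0) :
    DifferentiableOn ℂ (antidiff2 a b u) zetaDomain := by
  intro s hs
  obtain ⟨h1, h2⟩ := ne_of_mem_zetaDomain hs
  have := differentiableAt_const_cpow hu 1 s
  have := differentiableAt_const_cpow hu 2 s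
  have := differentiableAt_const_cpow_neg hu s
  have : a * b * ((1 - s) * (2 - s)) ≠ 0 := mul_ne_zero (mul_ne_zero ha hb) (mul_ne_zero h1 h2)
  refine DifferentiableAt.differentiableWithinAt ?_
  unfold antidiff2
  fun_prop (disch := assumption)

/-- The derivative at `s = 0` of the antidifference of `u ^ (-s)` with step `a`. -/
def antidiffLog1 (a u : ℂ) : ℂ := (u / a - 1 / 2) * Complex.log u - u / a

/-- The derivative at `s = 0` of the antidifference of `u ^ (-s)` with steps `a` and `b`. -/
def antidiffLog2 (a b u : ℂ) : ℂ :=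
  (3 * u ^ 2 / 4 - u ^ 2 * Complex.log u / 2) / (a * b) -
    (a + b) / (2 * a * b) * (u - u * Complex.log u) -
    (a / (12 * b) + b / (12 * a) + 1 / 4) * Complex.log u

lemma hasDerivAt_cpow_sub {u : ℂ} (hu : u ≠ 0) (c : ℂ) :
    HasDerivAt (fun s => u ^ (c - s)) (-(u ^ c * Complex.log u)) 0 := by
  have h := ((hasDerivAt_const (0 : ℂ) c).sub (hasDerivAt_id 0)).const_cpow (c := u) (Or.inl hu)
  refine h.congr_deriv ?_
  simp

lemma hasDerivAt_cpow_neg {u : ℂ} (hu : u ≠ 0) :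
    HasDerivAt (fun s : ℂ => u ^ (-s)) (-Complex.log u) 0 := by
  simpa using hasDerivAt_cpow_sub hu 0

lemma hasDerivAt_antidiff1 {a u : ℂ} (ha : a ≠ 0) (hu : u ≠ 0) :
    HasDerivAt (antidiff1 a u) (antidiffLog1 a u) 0 := by
  have h1 := hasDerivAt_cpow_sub hu 1
  have h2 := hasDerivAt_cpow_neg hu
  have h3 : HasDerivAt (fun s : ℂ => a * (1 - s)) (a * (-1)) 0 :=
    ((hasDerivAt_id (0 : ℂ)).const_sub 1).const_mul a
  refine ((h1.div h3 (by simpa using ha)).neg.add (h2.div_const 2)).congr_deriv ?_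
  simp only [antidiffLog1, sub_zero, Complex.cpow_one]
  field_simp
  ring

lemma hasDerivAt_antidiff2 {a b u : ℂ} (ha : a ≠ 0) (hb : b ≠ 0) (hu : u ≠ 0) :
    HasDerivAt (antidiff2 a b u) (antidiffLog2 a b u) 0 := by
  have h0 := hasDerivAt_cpow_sub hu 2
  have h1 := hasDerivAt_cpow_sub hu 1
  have h2 := hasDerivAt_cpow_neg hu
  have h3 : HasDerivAt (fun s : ℂ => 1 - s) (-1) 0 := (hasDerivAt_id (0 : ℂ)).const_sub 1
  have h4 : HasDerivAt (fun s : ℂ => 2 - s) (-1) 0 := (hasDerivAt_id (0 : ℂ)).const_sub 2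
  refine (((h0.div ((h3.mul h4).const_mul (a * b)) (by simp [ha, hb])).sub
    ((h1.div h3 (by simp)).const_mul _)).add (h2.const_mul _)).congr_deriv ?_
  simp only [antidiffLog2, Pi.mul_apply, sub_zero, Complex.cpow_one, Complex.cpow_ofNat]
  field_simp
  ring

/-! ### The zeta function of an arithmetic progression -/

/-- The zeta series `∑_{n ≥ 0} (x + n a) ^ (-s)` of an arithmetic progression. -/
def progressionZetaSeries (x a s : ℂ) : ℂ := ∑' n : ℕ, (x + n * a) ^ (-s)

lemma summable_barnesZeta2Series (x : ℂ) {a b s : ℂ} (ha : 0 < a.re) (hb : 0 < b.re)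
    (hs : 2 < s.re) : Summable fun n : ℕ × ℕ => (x + n.1 * a + n.2 * b) ^ (-s) := by
  set δ := min a.re b.re with hδdef
  have hδ : 0 < δ := lt_min ha hb
  have hmaj := (summable_lattice_rpow hs (half_pos hδ)).mul_left (Real.exp (Real.pi * ‖s‖))
  refine Summable.of_norm_bounded_eventually hmaj ?_
  obtain ⟨K, hK⟩ := exists_nat_ge ((2 * |x.re| + δ) / δ)
  have hfin : {n : ℕ × ℕ | n.1 + n.2 < K}.Finite :=
    ((Set.finite_lt_nat K).prod (Set.finite_lt_nat K)).subset fun n hn =>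
      ⟨lt_of_le_of_lt (Nat.le_add_right _ _) hn, lt_of_le_of_lt (Nat.le_add_left _ _) hn⟩
  refine hfin.subset fun n hn => ?_
  by_contra hlt
  refine hn ?_
  have hKn : (K : ℝ) ≤ (n.1 : ℝ) + n.2 := by
    simp only [Set.mem_ofPred_eq, not_lt] at hlt
    exact_mod_cast hlt
  have h1 : 2 * |x.re| + δ ≤ δ * ((n.1 : ℝ) + n.2) := by
    have := (div_le_iff₀ hδ).1 (hK.trans hKn)
    linarith
  have h2 : δ / 2 * ((n.1 : ℝ) + n.2 + 1) ≤ ‖x + n.1 * a + n.2 * b‖ := by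
    refine le_trans ?_ (Complex.re_le_norm _)
    rw [re_add_natCast_mul, re_add_natCast_mul]
    have h3 : (n.1 : ℝ) * δ ≤ n.1 * a.re := by gcongr; exact min_le_left _ _
    have h4 : (n.2 : ℝ) * δ ≤ n.2 * b.re := by gcongr; exact min_le_right _ _
    have h5 := neg_abs_le x.re
    linarith
  refine (norm_cpow_le_of_norm_le (norm_neg s).le).trans ?_
  gcongr Real.exp (Real.pi * ‖s‖) * ?_
  rw [Complex.neg_re]
  exact Real.rpow_le_rpow_of_nonpos (by positivity) h2 (by linarith)

lemma summable_progressionZetaSeries (x : ℂ) {a s : ℂ} (ha : 0 < a.re) (hs : 2 < s.re) :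
    Summable fun n : ℕ => (x + n * a) ^ (-s) := by
  have h := (summable_barnesZeta2Series x ha ha hs).comp_injective
    (Prod.mk_left_injective (0 : ℕ))
  refine h.congr fun n => ?_
  simp

lemma progressionZetaSeries_shift (x : ℂ) {a s : ℂ} (ha : 0 < a.re) (hs : 2 < s.re) :
    progressionZetaSeries x a s = x ^ (-s) + progressionZetaSeries (x + a) a s := by
  rw [progressionZetaSeries, (summable_progressionZetaSeries x ha hs).tsum_eq_zero_add]
  simp only [Nat.cast_zero, zero_mul, add_zero]
  congr 1
  refine tsum_congr fun n => ?_
  push_cast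
  ring_nf

lemma barnesZeta2Series_shift (x : ℂ) {a b s : ℂ} (ha : 0 < a.re) (hb : 0 < b.re)
    (hs : 2 < s.re) :
    barnesZeta2Series x a b s = progressionZetaSeries x a s + barnesZeta2Series (x + b) a b s := by
  have h1 := summable_barnesZeta2Series x ha hb hs
  have h2 := summable_barnesZeta2Series (x + b) ha hb hs
  have h3 := summable_progressionZetaSeries x ha hs
  rw [barnesZeta2Series, barnesZeta2Series, progressionZetaSeries, h1.tsum_prod, h2.tsum_prod,
    ← h3.tsum_add h2.prod]
  refine tsum_congr fun m => ?_
  have hm : Summable fun n : ℕ => (x + m * a + n * b) ^ (-s) := by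
    simpa only [Function.comp_def] using h1.comp_injective (Prod.mk_right_injective m)
  rw [hm.tsum_eq_zero_add]
  simp only [Nat.cast_zero, zero_mul, add_zero]
  congr 1
  refine tsum_congr fun n => ?_
  push_cast
  ring_nf

lemma differentiableOn_const_cpow_neg {u : ℂ} (hu : u ≠ 0) :
    DifferentiableOn ℂ (fun s => u ^ (-s)) zetaDomain :=
  fun s _ => (differentiableAt_const_cpow_neg hu s).differentiableWithinAt

lemma differentiableOn_error1 {a u : ℂ} (ha : a ≠ 0) (hu : u ≠ 0) (hua : u + a ≠ 0) :
    DifferentiableOn ℂ (error1 a u) zetaDomain :=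
  ((differentiableOn_const_cpow_neg hu).sub (differentiableOn_antidiff1 ha hu)).add
    (differentiableOn_antidiff1 ha hua)

lemma hasDerivAt_error1 {a u : ℂ} (ha : a ≠ 0) (hu : u ≠ 0) (hua : u + a ≠ 0) :
    HasDerivAt (error1 a u)
      (-Complex.log u - antidiffLog1 a u + antidiffLog1 a (u + a)) 0 :=
  ((hasDerivAt_cpow_neg hu).sub (hasDerivAt_antidiff1 ha hu)).add (hasDerivAt_antidiff1 ha hua)

/-- The continuation of the zeta series of a progression that starts far to the right, and the
series for its derivative at `0`. -/
lemma exists_continuation_progression_of_good {x a : ℂ} (ha : 0 < a.re) (hx1 : 1 ≤ x.re)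
    (hx : 2 * ‖a‖ ≤ x.re) : ∃ Z, IsContinuation (progressionZetaSeries x a) Z ∧
      HasSum (fun n : ℕ => -Complex.log (x + n * a) - antidiffLog1 a (x + n * a) +
        antidiffLog1 a (x + n * a + a)) (deriv Z 0 - antidiffLog1 a x) := by
  have ha0 : a ≠ 0 := by rintro rfl; simp at ha
  have hre : ∀ n : ℕ, x.re ≤ (x + n * a).re := fun n => by
    rw [re_add_natCast_mul]
    have := mul_nonneg n.cast_nonneg (α := ℝ) ha.le
    linarith
  have hne : ∀ n : ℕ, x + n * a ≠ 0 := fun n h => by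
    have := hre n
    rw [h, Complex.zero_re] at this
    linarith
  have hne' : ∀ n : ℕ, x + n * a + a ≠ 0 := fun n h => by
    have := hne (n + 1)
    push_cast at this
    exact this (by rw [← h]; ring)
  have hx0 : x ≠ 0 := by simpa using hne 0
  set δ := min a.re 1 with hδdef
  have hδ : 0 < δ := lt_min ha one_pos
  have hlow : ∀ n : ℕ, δ * ((n : ℝ) + 1) ≤ ‖x + n * a‖ := fun n => by
    refine le_trans ?_ (Complex.re_le_norm _)
    rw [re_add_natCast_mul]
    have h3 : (n : ℝ) * δ ≤ n * a.re := by gcongr; exact min_le_left _ _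
    have h4 : δ ≤ 1 := min_le_right _ _
    linarith
  have hd : ∀ n : ℕ, DifferentiableOn ℂ (error1 a (x + n * a)) zetaDomain := fun n =>
    differentiableOn_error1 ha0 (hne n) (hne' n)
  have hb : ∀ σ ε B : ℝ, -1 < σ → 0 < ε → ∃ M : ℕ → ℝ, Summable M ∧
      ∀ n : ℕ, ∀ s ∈ zetaBox σ ε B, ‖error1 a (x + n * a) s‖ ≤ M n := by
    intro σ ε B hσ hε
    obtain ⟨C, hC, key⟩ := error1_bound (σ := σ) (B := B) (M := ‖a‖) hε (norm_pos_iff.2 ha0)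
    refine ⟨_, (summable_nat_rpow (by linarith : 1 < σ + 2) hδ).mul_left C, fun n s hs => ?_⟩
    have hn := hre n
    have hn' := Complex.re_le_norm (x + n * a)
    refine (key a le_rfl le_rfl s hs _ (by linarith) (by linarith) (by linarith)).trans ?_
    gcongr C * ?_
    exact Real.rpow_le_rpow_of_nonpos (by positivity) (hlow n) (by linarith)
  have hA := differentiableOn_antidiff1 (u := x) ha0 hx0
  have hE := analyticOnNhd_tsum hd hb
  refine ⟨fun s => antidiff1 a x s + ∑' n : ℕ, error1 a (x + n * a) s,
    ⟨(hA.analyticOnNhd isOpen_zetaDomain).add hE, fun s hs => ?_⟩, ?_⟩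
  · have hsum := summable_progressionZetaSeries x ha hs
    have hsd : s ∈ zetaDomain := ⟨by simp only [Set.mem_ofPred_eq]; linarith, by
      rintro (rfl | rfl) <;> norm_num at hs⟩
    obtain ⟨σ, ε, B, hσ, hε, hbox⟩ := exists_mem_zetaBox hsd
    obtain ⟨M, hM, hFM⟩ := hb σ ε B hσ hε
    have hesum : Summable fun n : ℕ => error1 a (x + n * a) s :=
      Summable.of_norm_bounded hM fun n => hFM n s hbox
    have hdiff : ∀ n : ℕ, (x + n * a) ^ (-s) - error1 a (x + n * a) s =
        antidiff1 a (x + n * a) s - antidiff1 a (x + (n + 1 : ℕ) * a) s := by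
      intro n
      have : x + (n + 1 : ℕ) * a = x + n * a + a := by push_cast; ring
      rw [this, error1]
      ring
    have htend : Tendsto (fun n : ℕ => antidiff1 a (x + n * a) s) atTop (𝓝 0) := by
      have hu := tendsto_norm_add_natCast_mul x ha0
      have t1 := tendsto_cpow_zero (c := 1 - s) hu (by simp; linarith)
      have t2 := tendsto_cpow_zero (c := -s) hu (by simp; linarith)
      have := ((t1.div_const (a * (1 - s))).neg).add (t2.div_const 2)
      simpa [antidiff1] using this
    have hs' := hsum.sub hesum
    have ht := tsum_sub_succ (φ := fun n : ℕ => antidiff1 a (x + n * a) s)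
      (hs'.congr fun n => hdiff n) htend
    rw [progressionZetaSeries]
    have h3 := hsum.tsum_sub hesum
    rw [tsum_congr hdiff, ht] at h3
    simp only [Nat.cast_zero, zero_mul, add_zero] at h3
    rw [h3]
    ring
  · have h1 := hasSum_deriv_zero hd hb
    have h2 : deriv (fun s => antidiff1 a x s + ∑' n : ℕ, error1 a (x + n * a) s) 0 =
        antidiffLog1 a x + deriv (fun s => ∑' n : ℕ, error1 a (x + n * a) s) 0 := by
      rw [deriv_fun_add (hasDerivAt_antidiff1 ha0 hx0).differentiableAt
        (hE 0 zero_mem_zetaDomain).differentiableAt, (hasDerivAt_antidiff1 ha0 hx0).deriv]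
    rw [h2, add_sub_cancel_left]
    convert h1 using 2 with n
    exact (hasDerivAt_error1 ha0 (hne n) (hne' n)).deriv.symm

/-! ### The Barnes double zeta function -/

/-- The point `x` lies far to the right, relative to parameters `a`, `b` in a compact part of the
right half-plane. -/
structure IsFarRight (δ M : ℝ) (x a b : ℂ) : Prop where
  pos : 0 < δ
  le_one : δ ≤ 1
  left : δ ≤ a.re
  right : δ ≤ b.re
  left_le : ‖a‖ ≤ M
  right_le : ‖b‖ ≤ M
  one_le : 1 ≤ x.re
  le : 4 * M ≤ x.re

section

variable {δ M : ℝ} {x a b : ℂ}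

lemma IsFarRight.left_ne (h : IsFarRight δ M x a b) : a ≠ 0 := by
  rintro rfl
  have := h.left
  have := h.pos
  simp only [Complex.zero_re] at *
  linarith

lemma IsFarRight.right_ne (h : IsFarRight δ M x a b) : b ≠ 0 := by
  rintro rfl
  have := h.right
  have := h.pos
  simp only [Complex.zero_re] at *
  linarith

lemma IsFarRight.le_re (h : IsFarRight δ M x a b) (m n : ℕ) :
    x.re ≤ (x + m * a + n * b).re ∧ δ * ((m : ℝ) + n + 1) ≤ (x + m * a + n * b).re := by
  rw [re_add_natCast_mul, re_add_natCast_mul]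
  have h1 : (m : ℝ) * δ ≤ m * a.re := by gcongr; exact h.left
  have h2 : (n : ℝ) * δ ≤ n * b.re := by gcongr; exact h.right
  have h3 := mul_nonneg m.cast_nonneg (α := ℝ) h.pos.le
  have h4 := mul_nonneg n.cast_nonneg (α := ℝ) h.pos.le
  have := h.le_one
  have := h.one_le
  constructor <;> linarith

lemma IsFarRight.re_pos (h : IsFarRight δ M x a b) (m n : ℕ) : 0 < (x + m * a + n * b).re := by
  have := (h.le_re m n).1
  have := h.one_le
  linarith

lemma IsFarRight.ne (h : IsFarRight δ M x a b) (m n : ℕ) : x + m * a + n * b ≠ 0 := fun e => by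
  have := h.re_pos m n
  rw [e, Complex.zero_re] at this
  exact lt_irrefl _ this

lemma IsFarRight.re_pos_add (h : IsFarRight δ M x a b) (m n : ℕ) :
    0 < (x + m * a + n * b + a).re ∧ 0 < (x + m * a + n * b + b).re ∧
      0 < (x + m * a + n * b + a + b).re := by
  have h0 := h.re_pos m n
  have h1 := h.pos.trans_le h.left
  have h2 := h.pos.trans_le h.right
  simp only [Complex.add_re] at *
  refine ⟨?_, ?_, ?_⟩ <;> linarith

lemma ne_zero_of_re_pos {z : ℂ} (hz : 0 < z.re) : z ≠ 0 := by
  rintro rfl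
  simp at hz

lemma differentiableOn_error2 {u : ℂ} (ha : a ≠ 0) (hb : b ≠ 0) (hu : u ≠ 0) (hua : u + a ≠ 0)
    (hub : u + b ≠ 0) (huab : u + a + b ≠ 0) :
    DifferentiableOn ℂ (error2 a b u) zetaDomain :=
  (differentiableOn_const_cpow_neg hu).sub
    ((((differentiableOn_antidiff2 ha hb hu).sub (differentiableOn_antidiff2 ha hb hua)).sub
    (differentiableOn_antidiff2 ha hb hub)).add (differentiableOn_antidiff2 ha hb huab))

/-- The derivative at `s = 0` of the error of the antidifference with two steps. -/
def errorLog2 (a b u : ℂ) : ℂ :=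
  -Complex.log u - (antidiffLog2 a b u - antidiffLog2 a b (u + a) - antidiffLog2 a b (u + b) +
    antidiffLog2 a b (u + a + b))

lemma hasDerivAt_error2 {u : ℂ} (ha : a ≠ 0) (hb : b ≠ 0) (hu : u ≠ 0) (hua : u + a ≠ 0)
    (hub : u + b ≠ 0) (huab : u + a + b ≠ 0) :
    HasDerivAt (error2 a b u) (errorLog2 a b u) 0 :=
  (hasDerivAt_cpow_neg hu).sub
    ((((hasDerivAt_antidiff2 ha hb hu).sub (hasDerivAt_antidiff2 ha hb hua)).sub
    (hasDerivAt_antidiff2 ha hb hub)).add (hasDerivAt_antidiff2 ha hb huab))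

/-- The error terms over the lattice points are dominated by a convergent series, uniformly in all
parameters. -/
lemma exists_error2_majorant {σ ε B : ℝ} (hσ : -1 < σ) (hε : 0 < ε) (hδ : 0 < δ) (M : ℝ) :
    ∃ C : ℕ × ℕ → ℝ, Summable C ∧ ∀ x a b : ℂ, IsFarRight δ M x a b → ∀ n : ℕ × ℕ,
      ∀ s ∈ zetaBox σ ε B, ‖error2 a b (x + n.1 * a + n.2 * b) s‖ ≤ C n := by
  obtain ⟨C, hC, key⟩ := error2_bound (σ := σ) (B := B) (M := M) hε hδ
  refine ⟨_, (summable_lattice_rpow (by linarith : 2 < σ + 3) hδ).mul_left C,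
    fun x a b h n s hs => ?_⟩
  obtain ⟨h1, h2⟩ := h.le_re n.1 n.2
  have h3 := Complex.re_le_norm (x + n.1 * a + n.2 * b)
  have h4 := h.one_le
  have h5 := h.le
  refine (key a b (h.left.trans (Complex.re_le_norm a)) h.left_le
    (h.right.trans (Complex.re_le_norm b)) h.right_le s hs _ (h.re_pos _ _) (by linarith)
    (by linarith)).trans ?_
  gcongr C * ?_
  exact Real.rpow_le_rpow_of_nonpos (by positivity) (h2.trans h3) (by linarith)

lemma IsFarRight.differentiableOn (h : IsFarRight δ M x a b) (n : ℕ × ℕ) :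
    DifferentiableOn ℂ (error2 a b (x + n.1 * a + n.2 * b)) zetaDomain := by
  obtain ⟨h1, h2, h3⟩ := h.re_pos_add n.1 n.2
  exact differentiableOn_error2 h.left_ne h.right_ne (h.ne _ _) (ne_zero_of_re_pos h1)
    (ne_zero_of_re_pos h2) (ne_zero_of_re_pos h3)

lemma IsFarRight.hasDerivAt (h : IsFarRight δ M x a b) (n : ℕ × ℕ) :
    HasDerivAt (error2 a b (x + n.1 * a + n.2 * b)) (errorLog2 a b (x + n.1 * a + n.2 * b)) 0 := by
  obtain ⟨h1, h2, h3⟩ := h.re_pos_add n.1 n.2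
  exact hasDerivAt_error2 h.left_ne h.right_ne (h.ne _ _) (ne_zero_of_re_pos h1)
    (ne_zero_of_re_pos h2) (ne_zero_of_re_pos h3)

/-- The continuation of the Barnes double zeta series, and its derivative at `0`, for `x` far to
the right. -/
lemma IsFarRight.exists_continuation (h : IsFarRight δ M x a b) :
    ∃ Z, IsContinuation (barnesZeta2Series x a b) Z ∧ deriv Z 0 = antidiffLog2 a b x +
      ∑' n : ℕ × ℕ, errorLog2 a b (x + n.1 * a + n.2 * b) := by
  have ha0 := h.left_ne
  have hb0 := h.right_ne
  have hx0 : x ≠ 0 := by simpa using h.ne 0 0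
  have hd := h.differentiableOn
  have hb : ∀ σ ε B : ℝ, -1 < σ → 0 < ε → ∃ M : ℕ × ℕ → ℝ, Summable M ∧
      ∀ n : ℕ × ℕ, ∀ s ∈ zetaBox σ ε B, ‖error2 a b (x + n.1 * a + n.2 * b) s‖ ≤ M n := by
    intro σ ε B hσ hε
    obtain ⟨C, hC, key⟩ := exists_error2_majorant (B := B) hσ hε h.pos M
    exact ⟨C, hC, key x a b h⟩
  have hA := differentiableOn_antidiff2 (u := x) ha0 hb0 hx0
  have hE := analyticOnNhd_tsum hd hb
  refine ⟨fun s => antidiff2 a b x s + ∑' n : ℕ × ℕ, error2 a b (x + n.1 * a + n.2 * b) s,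
    ⟨(hA.analyticOnNhd isOpen_zetaDomain).add hE, fun s hs => ?_⟩, ?_⟩
  · have hsum := summable_barnesZeta2Series x (h.pos.trans_le h.left) (h.pos.trans_le h.right) hs
    have hsd : s ∈ zetaDomain := ⟨by simp only [Set.mem_ofPred_eq]; linarith, by
      rintro (rfl | rfl) <;> norm_num at hs⟩
    obtain ⟨σ, ε, B, hσ, hε, hbox⟩ := exists_mem_zetaBox hsd
    obtain ⟨M, hM, hFM⟩ := hb σ ε B hσ hε
    have hesum : Summable fun n : ℕ × ℕ => error2 a b (x + n.1 * a + n.2 * b) s :=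
      Summable.of_norm_bounded hM fun n => hFM n s hbox
    set φ : ℕ → ℕ → ℂ := fun m n => antidiff2 a b (x + m * a + n * b) s with hφ
    have hdiff : ∀ n : ℕ × ℕ,
        (x + n.1 * a + n.2 * b) ^ (-s) - error2 a b (x + n.1 * a + n.2 * b) s =
        φ n.1 n.2 - φ (n.1 + 1) n.2 - φ n.1 (n.2 + 1) + φ (n.1 + 1) (n.2 + 1) := by
      intro n
      have e1 : x + (n.1 + 1 : ℕ) * a + n.2 * b = x + n.1 * a + n.2 * b + a := by push_cast; ring
      have e2 : x + n.1 * a + (n.2 + 1 : ℕ) * b = x + n.1 * a + n.2 * b + b := by push_cast; ring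
      have e3 : x + (n.1 + 1 : ℕ) * a + (n.2 + 1 : ℕ) * b = x + n.1 * a + n.2 * b + a + b := by
        push_cast; ring
      simp only [hφ]
      rw [e1, e2, e3, error2]
      ring
    have htend : ∀ u : ℕ → ℂ, Tendsto (fun n => ‖u n‖) atTop atTop →
        Tendsto (fun n : ℕ => antidiff2 a b (u n) s) atTop (𝓝 0) := by
      intro u hu
      have t0 := tendsto_cpow_zero (c := 2 - s) hu (by simp; linarith)
      have t1 := tendsto_cpow_zero (c := 1 - s) hu (by simp; linarith)
      have t2 := tendsto_cpow_zero (c := -s) hu (by simp; linarith)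
      have := ((t0.div_const (a * b * ((1 - s) * (2 - s)))).sub
        ((t1.div_const (1 - s)).const_mul ((a + b) / (2 * a * b)))).add
        (t2.const_mul (a / (12 * b) + b / (12 * a) + 1 / 4))
      simpa [antidiff2] using this
    have hs' := hsum.sub hesum
    have ht := tsum_second_difference (φ := φ) (hs'.congr fun n => hdiff n)
      (fun m => htend _ (tendsto_norm_add_natCast_mul _ hb0))
      (htend (fun m : ℕ => x + m * a + (0 : ℕ) * b)
        (by simpa using tendsto_norm_add_natCast_mul x ha0))
    have h3 := hsum.tsum_sub hesum
    rw [tsum_congr hdiff, ht] at h3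
    simp only [hφ, Nat.cast_zero, zero_mul, add_zero] at h3
    rw [barnesZeta2Series, h3]
    ring
  · have h1 := hasSum_deriv_zero hd hb
    rw [deriv_fun_add (hasDerivAt_antidiff2 ha0 hb0 hx0).differentiableAt
        (hE 0 zero_mem_zetaDomain).differentiableAt, (hasDerivAt_antidiff2 ha0 hb0 hx0).deriv,
        ← h1.tsum_eq]
    congr 1
    exact tsum_congr fun n => (h.hasDerivAt n).deriv

/-- The derivatives of the error terms at `s = 0` are dominated by a convergent series, uniformly
in all parameters. -/
lemma exists_errorLog2_majorant (hδ : 0 < δ) (M : ℝ) :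
    ∃ C : ℕ × ℕ → ℝ, Summable C ∧ ∀ x a b : ℂ, IsFarRight δ M x a b → ∀ n : ℕ × ℕ,
      ‖errorLog2 a b (x + n.1 * a + n.2 * b)‖ ≤ C n := by
  obtain ⟨C, hC, key⟩ := exists_error2_majorant (σ := -3 / 4) (ε := 1 / 4) (B := 1) (by norm_num)
    (by norm_num) hδ M
  -- The Cauchy estimate on the disc `|s| ≤ 1 / 2`, which lies in the box just chosen.
  refine ⟨fun n => C n / (1 / 2), hC.div_const _, fun x a b h n => ?_⟩
  rw [← (h.hasDerivAt n).deriv]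
  have hsub : Metric.closedBall (0 : ℂ) (1 / 2) ⊆ zetaBox (-3 / 4) (1 / 4) 1 := by
    intro s hs
    have hs' : ‖s‖ ≤ 1 / 2 := mem_closedBall_zero_iff.1 hs
    have h1 := (abs_le.1 (Complex.abs_re_le_norm s)).1
    have h2 := norm_sub_norm_le (1 : ℂ) s
    have h3 := norm_sub_norm_le (2 : ℂ) s
    rw [norm_one] at h2
    rw [Complex.norm_ofNat] at h3
    refine ⟨by linarith, by linarith, by linarith, by linarith⟩
  refine Complex.norm_deriv_le_of_forall_mem_sphere_norm_le (by norm_num) ?_ fun s hs =>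
    key x a b h n s (hsub (Metric.sphere_subset_closedBall hs))
  have := (h.differentiableOn n).mono (hsub.trans (zetaBox_subset (by norm_num) (by norm_num)))
  exact this.diffContOnCl_ball subset_rfl

end

/-! ### The gamma function as the derivative of a zeta function -/

lemma log_mul_of_re_pos {u v : ℂ} (hu : 0 < u.re) (hv : 0 < v.re) :
    Complex.log (u * v) = Complex.log u + Complex.log v := by
  have h1 := abs_lt.1 (Complex.abs_arg_lt_pi_div_two_iff.2 (Or.inl hu))
  have h2 := abs_lt.1 (Complex.abs_arg_lt_pi_div_two_iff.2 (Or.inl hv))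
  exact Complex.log_mul (ne_zero_of_re_pos hu) (ne_zero_of_re_pos hv)
    ⟨by linarith, by linarith⟩

lemma factorial_eq_stirlingSeq {N : ℕ} (hN : N ≠ 0) : ((N.factorial : ℕ) : ℂ) =
    (Stirling.stirlingSeq N : ℂ) * ((Real.sqrt 2 : ℂ) * Complex.exp (Complex.log N / 2) *
      Complex.exp (N * (Complex.log N - 1))) := by
  have hN' : (0 : ℝ) < N := Nat.cast_pos.2 (Nat.pos_of_ne_zero hN)
  have h : (N.factorial : ℝ) = Stirling.stirlingSeq N * (Real.sqrt 2 *
      Real.exp (Real.log N / 2) * Real.exp (N * (Real.log N - 1))) := by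
    have h1 : Real.sqrt N = Real.exp (Real.log N / 2) := by rw [Real.exp_half, Real.exp_log hN']
    have h2 : ((N : ℝ) / Real.exp 1) ^ N = Real.exp (N * (Real.log N - 1)) := by
      rw [Real.exp_nat_mul, Real.exp_sub, Real.exp_log hN']
    rw [← h1, ← h2, ← Real.sqrt_mul zero_le_two, Stirling.stirlingSeq]
    have h3 : Real.sqrt (2 * N) ≠ 0 := Real.sqrt_ne_zero'.2 (by positivity)
    have h4 : ((N : ℝ) / Real.exp 1) ^ N ≠ 0 := by positivity
    field_simp
  have hlog : (Complex.log N) = ((Real.log N : ℝ) : ℂ) := by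
    rw [Complex.ofReal_log hN'.le, Complex.ofReal_natCast]
  rw [hlog]
  exact_mod_cast congrArg (fun r : ℝ => (r : ℂ)) h

/-- The finite product attached to a progression, in terms of the products in Euler's limit for the
gamma function and in Stirling's formula. -/
lemma exp_antidiffLog1_div_prod {a y : ℂ} {N : ℕ} (ha : 0 < a.re) (hN : N ≠ 0)
    (hN2 : 0 < (1 + y / N).re) (hS : Stirling.stirlingSeq N ≠ 0) :
    Complex.exp (antidiffLog1 a (a * (y + N))) / ∏ n ∈ Finset.range N, (a * (y + n)) =
      Complex.exp (Complex.log a * (y - 1 / 2)) * Complex.GammaSeq y N *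
        (Complex.exp ((N + y + 1 / 2) * Complex.log (1 + y / N)) * Complex.exp (-y) /
          ((Real.sqrt 2 : ℂ) * (Stirling.stirlingSeq N : ℂ))) := by
  have ha0 := ne_zero_of_re_pos ha
  have hN0 : (N : ℂ) ≠ 0 := Nat.cast_ne_zero.2 hN
  have hNre : 0 < (N : ℂ).re := by
    rw [Complex.natCast_re]
    exact Nat.cast_pos.2 (Nat.pos_of_ne_zero hN)
  have hyN : y + N = N * (1 + y / N) := by field_simp; ring
  have hlogyN : Complex.log (y + N) = Complex.log N + Complex.log (1 + y / N) := by
    rw [hyN, log_mul_of_re_pos hNre hN2]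
  have hyN0 : y + N ≠ 0 := by
    rw [hyN]
    exact mul_ne_zero hN0 (ne_zero_of_re_pos hN2)
  have hexpyN : Complex.exp (Complex.log N + Complex.log (1 + y / N)) = y + N := by
    rw [← hlogyN, Complex.exp_log hyN0]
  have hlog : Complex.log (a * (y + N)) =
      Complex.log a + (Complex.log N + Complex.log (1 + y / N)) := by
    have e1 : a * (y + N) = N * (a * (1 + y / N)) := by rw [hyN]; ring
    have e2 := Complex.log_ofReal_mul (r := N) (Nat.cast_pos.2 (Nat.pos_of_ne_zero hN))
      (mul_ne_zero ha0 (ne_zero_of_re_pos hN2))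
    rw [Complex.ofReal_log (Nat.cast_nonneg N), Complex.ofReal_natCast,
      log_mul_of_re_pos ha hN2] at e2
    rw [e1, e2]
    ring
  have hprod : ∏ n ∈ Finset.range N, (a * (y + n)) =
      Complex.exp (N * Complex.log a) * ∏ n ∈ Finset.range N, (y + n) := by
    rw [Finset.prod_mul_distrib, Finset.prod_const, Finset.card_range, Complex.exp_nat_mul,
      Complex.exp_log ha0]
  have hdiv : a * (y + N) / a = y + N := by field_simp
  have hS' : (Stirling.stirlingSeq N : ℂ) ≠ 0 := by exact_mod_cast hS
  have h2 : (Real.sqrt 2 : ℂ) ≠ 0 := by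
    exact_mod_cast (Real.sqrt_ne_zero'.2 zero_lt_two)
  rw [Complex.GammaSeq, Finset.prod_range_succ, factorial_eq_stirlingSeq hN, hprod,
    Complex.cpow_def_of_ne_zero hN0, antidiffLog1, hdiv, hlog]
  set l := Complex.log a
  set m := Complex.log N
  set k := Complex.log (1 + y / N)
  have hexp : Complex.exp ((y + N - 1 / 2) * (l + (m + k)) - (y + N)) * Complex.exp (m + k) =
      Complex.exp (N * l) * (Complex.exp (l * (y - 1 / 2)) * Complex.exp (m * y) *
        Complex.exp (m / 2) * Complex.exp (N * (m - 1)) *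
        Complex.exp ((N + y + 1 / 2) * k) * Complex.exp (-y)) := by
    simp only [← Complex.exp_add]
    congr 1
    ring
  rw [hexpyN] at hexp
  have hQ := Complex.exp_ne_zero (N * l)
  rw [← div_div, eq_div_of_mul_eq hyN0 hexp]
  field_simp

lemma tendsto_exp_antidiffLog1_div_prod {a : ℂ} (ha : 0 < a.re) (y : ℂ) :
    Tendsto (fun N : ℕ => Complex.exp (antidiffLog1 a (a * (y + N))) /
      ∏ n ∈ Finset.range N, (a * (y + n))) atTop
      (𝓝 (Complex.exp (Complex.log a * (y - 1 / 2)) * Complex.Gamma y /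
        (Real.sqrt (2 * Real.pi) : ℂ))) := by
  have hdiv : Tendsto (fun N : ℕ => y / (N : ℂ)) atTop (𝓝 0) :=
    tendsto_const_div_atTop_nhds_zero_nat y
  have h1 : Tendsto (fun N : ℕ => (N : ℂ) * Complex.log (1 + y / N)) atTop (𝓝 y) := by
    refine Complex.tendsto_nat_mul_log_one_add_of_tendsto ?_
    refine tendsto_const_nhds.congr' ?_
    filter_upwards [eventually_ne_atTop 0] with N hN
    have : (N : ℂ) ≠ 0 := Nat.cast_ne_zero.2 hN
    field_simp
  have h2 : Tendsto (fun N : ℕ => Complex.log (1 + y / N)) atTop (𝓝 0) := by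
    have : Tendsto (fun N : ℕ => 1 + y / (N : ℂ)) atTop (𝓝 1) := by
      simpa using hdiv.const_add 1
    simpa using this.clog Complex.one_mem_slitPlane
  have h3 : Tendsto (fun N : ℕ => Complex.exp ((N + y + 1 / 2) * Complex.log (1 + y / N)) *
      Complex.exp (-y)) atTop (𝓝 1) := by
    have := ((h1.add (h2.const_mul (y + 1 / 2))).cexp).mul_const (Complex.exp (-y))
    rw [mul_zero, add_zero, ← Complex.exp_add, add_neg_cancel, Complex.exp_zero] at this
    refine this.congr fun N => ?_
    congr 2
    ring
  have hst : Tendsto (fun N : ℕ => (Stirling.stirlingSeq N : ℂ)) atTop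
      (𝓝 (Real.sqrt Real.pi : ℂ)) :=
    (Complex.continuous_ofReal.tendsto _).comp Stirling.tendsto_stirlingSeq_sqrt_pi
  have hpi : (Real.sqrt Real.pi : ℝ) ≠ 0 := Real.sqrt_ne_zero'.2 Real.pi_pos
  have h20 : (Real.sqrt 2 : ℂ) ≠ 0 := by exact_mod_cast (Real.sqrt_ne_zero'.2 zero_lt_two)
  have hpi' : (Real.sqrt Real.pi : ℂ) ≠ 0 := by exact_mod_cast hpi
  have h4 := ((Complex.GammaSeq_tendsto_Gamma y).const_mul
    (Complex.exp (Complex.log a * (y - 1 / 2)))).mul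
    (h3.div (hst.const_mul (Real.sqrt 2 : ℂ)) (mul_ne_zero h20 hpi'))
  have hval : Complex.exp (Complex.log a * (y - 1 / 2)) * Complex.Gamma y *
      (1 / ((Real.sqrt 2 : ℂ) * (Real.sqrt Real.pi : ℂ))) =
      Complex.exp (Complex.log a * (y - 1 / 2)) * Complex.Gamma y /
        (Real.sqrt (2 * Real.pi) : ℂ) := by
    rw [Real.sqrt_mul zero_le_two, Complex.ofReal_mul, mul_one_div]
  rw [hval] at h4
  refine h4.congr' ?_
  have hre : ∀ᶠ N : ℕ in atTop, 0 < (1 + y / (N : ℂ)).re := by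
    have : Tendsto (fun N : ℕ => (1 + y / (N : ℂ)).re) atTop (𝓝 1) := by
      have := (Complex.continuous_re.tendsto _).comp (hdiv.const_add 1)
      rwa [add_zero, Complex.one_re] at this
    exact this.eventually (lt_mem_nhds zero_lt_one)
  filter_upwards [eventually_ne_atTop 0, hre,
    Stirling.tendsto_stirlingSeq_sqrt_pi.eventually_ne hpi] with N hN hN2 hS
  exact (exp_antidiffLog1_div_prod ha hN hN2 hS).symm

/-- The gamma function of the progression `x, x + a, x + 2 a, …`, namely
`a ^ (x / a - 1 / 2) Γ(x / a) / √(2π)`. It is the exponential of the derivative at `s = 0` of the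
zeta function of the progression, see `exists_continuation_progression`. -/
def progressionGamma (x a : ℂ) : ℂ :=
  Complex.exp (Complex.log a * (x / a - 1 / 2)) * Complex.Gamma (x / a) /
    (Real.sqrt (2 * Real.pi) : ℂ)

lemma progressionGamma_shift {x a : ℂ} (ha : a ≠ 0) (hx : x ≠ 0) :
    progressionGamma (x + a) a = x * progressionGamma x a := by
  have h : (x + a) / a = x / a + 1 := by field_simp
  rw [progressionGamma, progressionGamma, h, Complex.Gamma_add_one _ (div_ne_zero hx ha)]
  have e : Complex.exp (Complex.log a * (x / a + 1 - 1 / 2)) =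
      a * Complex.exp (Complex.log a * (x / a - 1 / 2)) := by
    have e' : Complex.log a * (x / a + 1 - 1 / 2) =
        Complex.log a + Complex.log a * (x / a - 1 / 2) := by ring
    rw [e', Complex.exp_add, Complex.exp_log ha]
  rw [e]
  field_simp

/-- The zeta function of any progression that avoids `0`, and its derivative at `s = 0`
(Lerch's formula). -/
lemma exists_continuation_progression {x a : ℂ} (ha : 0 < a.re) (hx : ∀ n : ℕ, x + n * a ≠ 0) :
    ∃ Z, IsContinuation (progressionZetaSeries x a) Z ∧
      Complex.exp (deriv Z 0) = progressionGamma x a := by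
  have ha0 := ne_zero_of_re_pos ha
  obtain ⟨K, hK⟩ : ∃ K : ℕ, max 1 (2 * ‖a‖) ≤ (x + K * a).re := by
    obtain ⟨K, hK⟩ := exists_nat_ge ((max 1 (2 * ‖a‖) - x.re) / a.re)
    refine ⟨K, ?_⟩
    rw [re_add_natCast_mul]
    have := (div_le_iff₀ ha).1 hK
    linarith
  induction K generalizing x with
  | zero =>
    rw [Nat.cast_zero, zero_mul, add_zero] at hK
    obtain ⟨Z, hZ, hsum⟩ := exists_continuation_progression_of_good ha
      ((le_max_left _ _).trans hK) ((le_max_right _ _).trans hK)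
    refine ⟨Z, hZ, tendsto_nhds_unique ?_ (tendsto_exp_antidiffLog1_div_prod ha (x / a))⟩
    have h1 := (hsum.tendsto_sum_nat.add_const (antidiffLog1 a x)).cexp
    rw [sub_add_cancel] at h1
    refine h1.congr fun N => ?_
    have e1 : ∀ n : ℕ, a * (x / a + n) = x + n * a := fun n => by field_simp
    simp only [e1]
    induction N with
    | zero => simp
    | succ N ih =>
      rw [Finset.sum_range_succ, Finset.prod_range_succ]
      have e2 : x + ((N + 1 : ℕ) : ℂ) * a = x + N * a + a := by push_cast; ring
      rw [add_right_comm, Complex.exp_add, ih, e2, Complex.exp_add, Complex.exp_sub,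
        Complex.exp_neg, Complex.exp_log (hx N)]
      have := Complex.exp_ne_zero (antidiffLog1 a (x + N * a))
      field_simp
  | succ K ih =>
    have e2 : ∀ n : ℕ, x + ((n + 1 : ℕ) : ℂ) * a = x + a + n * a := fun n => by push_cast; ring
    have hx0 : x ≠ 0 := by simpa using hx 0
    obtain ⟨Z, hZ, hd⟩ := ih (x := x + a) (fun n => by rw [← e2]; exact hx (n + 1))
      (by rw [← e2]; exact hK)
    -- Adding the first term `x ^ (-s)` divides the exponential of the derivative at `0` by `x`,
    -- whatever the branch of the power.
    refine ⟨fun s => x ^ (-s) + Z s, ⟨?_, fun s hs => ?_⟩, ?_⟩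
    · exact ((differentiableOn_const_cpow_neg hx0).analyticOnNhd isOpen_zetaDomain).add hZ.analytic
    · rw [hZ.eq s hs, progressionZetaSeries_shift x ha hs]
    · rw [deriv_fun_add (hasDerivAt_cpow_neg hx0).differentiableAt
        (hZ.analytic 0 zero_mem_zetaDomain).differentiableAt, (hasDerivAt_cpow_neg hx0).deriv,
        Complex.exp_add, hd, progressionGamma_shift ha0 hx0, Complex.exp_neg, Complex.exp_log hx0]
      field_simp

/-! ### The Barnes double gamma function in the right half-plane -/

/-- The point `x` is not a pole of `Γ₂(· | a, b)`. -/
def IsRegularPoint (x a b : ℂ) : Prop := ∀ m n : ℕ, x + m * a + n * b ≠ 0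

lemma IsRegularPoint.shift {x a b : ℂ} (h : IsRegularPoint x a b) :
    IsRegularPoint (x + b) a b := fun m n e => h m (n + 1) (by rw [← e]; push_cast; ring)

lemma exists_isFarRight {x a b : ℂ} (ha : 0 < a.re) (hb : 0 < b.re) :
    ∃ K : ℕ, ∃ δ M : ℝ, IsFarRight δ M (x + K * b) a b := by
  set δ := min 1 (min a.re b.re)
  set M := ‖a‖ + ‖b‖
  obtain ⟨K, hK⟩ := exists_nat_ge ((max 1 (4 * M) - x.re) / b.re)
  have h1 : max 1 (4 * M) ≤ (x + K * b).re := by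
    rw [re_add_natCast_mul]
    have := (div_le_iff₀ hb).1 hK
    linarith
  exact ⟨K, δ, M, lt_min one_pos (lt_min ha hb), min_le_left _ _,
    (min_le_right _ _).trans (min_le_left _ _), (min_le_right _ _).trans (min_le_right _ _),
    by simp [M], by simp [M], (le_max_left _ _).trans h1, (le_max_right _ _).trans h1⟩

lemma IsContinuation.shift {x a b : ℂ} {Z Z' : ℂ → ℂ} (ha : 0 < a.re) (hb : 0 < b.re)
    (h : IsContinuation (progressionZetaSeries x a) Z)
    (h' : IsContinuation (barnesZeta2Series (x + b) a b) Z') :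
    IsContinuation (barnesZeta2Series x a b) (Z + Z') := by
  refine ⟨(h.add h').analytic, fun s hs => ?_⟩
  rw [(h.add h').eq s hs, barnesZeta2Series_shift x ha hb hs]
  rfl

lemma exists_continuation_barnes {x a b : ℂ} (ha : 0 < a.re) (hb : 0 < b.re)
    (hx : IsRegularPoint x a b) : ∃ Z, IsContinuation (barnesZeta2Series x a b) Z := by
  obtain ⟨K, δ, M, hK⟩ := exists_isFarRight (x := x) ha hb
  induction K generalizing x with
  | zero =>
    rw [Nat.cast_zero, zero_mul, add_zero] at hK
    obtain ⟨Z, hZ, -⟩ := hK.exists_continuation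
    exact ⟨Z, hZ⟩
  | succ K ih =>
    obtain ⟨Z', hZ'⟩ := ih hx.shift (by convert hK using 1; push_cast; ring)
    obtain ⟨Z, hZ, -⟩ := exists_continuation_progression (x := x) ha
      (fun n => by simpa using hx n 0)
    exact ⟨_, hZ.shift ha hb hZ'⟩

/-- Any continuation of the zeta series computes the double gamma function. -/
lemma barnesGamma2RightHalf_eq {x a b : ℂ} {Z : ℂ → ℂ}
    (hZ : IsContinuation (barnesZeta2Series x a b) Z) :
    barnesGamma2RightHalf x a b = Complex.exp (deriv Z 0) := by
  have hex : ∃ Z : ℂ → ℂ, AnalyticOnNhd ℂ Z ({s | -1 < s.re} \ {1, 2}) ∧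
      ∀ s : ℂ, 2 < s.re → Z s = barnesZeta2Series x a b s := ⟨Z, hZ.analytic, hZ.eq⟩
  have h : IsContinuation (barnesZeta2Series x a b) (barnesZeta2 x a b) := by
    rw [barnesZeta2, dif_pos hex]
    exact ⟨hex.choose_spec.1, hex.choose_spec.2⟩
  rw [barnesGamma2RightHalf, (h.eventuallyEq hZ).deriv_eq]

/-- The difference equation of the double gamma function in the right half-plane. -/
lemma barnesGamma2RightHalf_shift {x a b : ℂ} (ha : 0 < a.re) (hb : 0 < b.re)
    (hx : IsRegularPoint x a b) : barnesGamma2RightHalf x a b =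
      progressionGamma x a * barnesGamma2RightHalf (x + b) a b := by
  obtain ⟨Z', hZ'⟩ := exists_continuation_barnes ha hb hx.shift
  obtain ⟨Z, hZ, hd⟩ := exists_continuation_progression (x := x) ha (fun n => by simpa using hx n 0)
  rw [barnesGamma2RightHalf_eq hZ', barnesGamma2RightHalf_eq (hZ.shift ha hb hZ'),
    deriv_add (hZ.analytic 0 zero_mem_zetaDomain).differentiableAt
    (hZ'.analytic 0 zero_mem_zetaDomain).differentiableAt, Complex.exp_add, hd]

lemma IsFarRight.barnesGamma2RightHalf_eq {δ M : ℝ} {x a b : ℂ} (h : IsFarRight δ M x a b) :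
    barnesGamma2RightHalf x a b = Complex.exp (antidiffLog2 a b x +
      ∑' n : ℕ × ℕ, errorLog2 a b (x + n.1 * a + n.2 * b)) := by
  obtain ⟨Z, hZ, hd⟩ := h.exists_continuation
  rw [QuantumRH.barnesGamma2RightHalf_eq hZ, hd]

lemma analyticAt_antidiffLog2 {A B U : ℂ × ℂ → ℂ} {p : ℂ × ℂ} (hA : AnalyticAt ℂ A p)
    (hB : AnalyticAt ℂ B p) (hU : AnalyticAt ℂ U p) (ha : A p ≠ 0) (hb : B p ≠ 0)
    (hu : 0 < (U p).re) : AnalyticAt ℂ (fun q => antidiffLog2 (A q) (B q) (U q)) p := by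
  have hlog : AnalyticAt ℂ (fun q => Complex.log (U q)) p := hU.clog (Or.inl hu)
  have h1 : A p * B p ≠ 0 := mul_ne_zero ha hb
  have h2 : 2 * A p * B p ≠ 0 := mul_ne_zero (mul_ne_zero two_ne_zero ha) hb
  have h3 : 12 * B p ≠ 0 := mul_ne_zero (by norm_num) hb
  have h4 : 12 * A p ≠ 0 := mul_ne_zero (by norm_num) ha
  unfold antidiffLog2
  fun_prop (disch := first | assumption | norm_num)

lemma analyticAt_errorLog2 {A B U : ℂ × ℂ → ℂ} {p : ℂ × ℂ} (hA : AnalyticAt ℂ A p)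
    (hB : AnalyticAt ℂ B p) (hU : AnalyticAt ℂ U p) (ha : 0 < (A p).re) (hb : 0 < (B p).re)
    (hu : 0 < (U p).re) : AnalyticAt ℂ (fun q => errorLog2 (A q) (B q) (U q)) p := by
  have hlog : AnalyticAt ℂ (fun q => Complex.log (U q)) p := hU.clog (Or.inl hu)
  have ha0 := ne_zero_of_re_pos ha
  have hb0 := ne_zero_of_re_pos hb
  have h1 := analyticAt_antidiffLog2 hA hB hU ha0 hb0 hu
  have h2 := analyticAt_antidiffLog2 hA hB (hU.add hA) ha0 hb0
    (by simp only [Pi.add_apply, Complex.add_re]; linarith)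
  have h3 := analyticAt_antidiffLog2 hA hB (hU.add hB) ha0 hb0
    (by simp only [Pi.add_apply, Complex.add_re]; linarith)
  have h4 := analyticAt_antidiffLog2 hA hB ((hU.add hA).add hB) ha0 hb0
    (by simp only [Pi.add_apply, Complex.add_re]; linarith)
  exact hlog.neg.sub (((h1.sub h2).sub h3).add h4)

/-- Far to the right, the double gamma function is locally the exponential of an analytic function
of its three arguments. -/
lemma exists_analyticAt_barnesGamma2RightHalf {X A B : ℂ × ℂ → ℂ} {p : ℂ × ℂ} {δ M : ℝ}
    (hX : AnalyticAt ℂ X p) (hA : AnalyticAt ℂ A p) (hB : AnalyticAt ℂ B p)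
    (h : ∀ᶠ q in 𝓝 p, IsFarRight δ M (X q) (A q) (B q)) :
    ∃ G : ℂ × ℂ → ℂ, AnalyticAt ℂ G p ∧
      ∀ᶠ q in 𝓝 p, barnesGamma2RightHalf (X q) (A q) (B q) = Complex.exp (G q) := by
  have hp := h.self_of_nhds
  refine ⟨fun q => antidiffLog2 (A q) (B q) (X q) +
    ∑' n : ℕ × ℕ, errorLog2 (A q) (B q) (X q + n.1 * A q + n.2 * B q), ?_, ?_⟩
  · obtain ⟨C, hC, key⟩ := exists_errorLog2_majorant hp.pos M
    refine (analyticAt_antidiffLog2 hA hB hX hp.left_ne hp.right_ne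
      (by linarith [hp.one_le])).add (analyticAt_tsum_of_summable hC ?_)
    filter_upwards [h, hX.eventually_analyticAt, hA.eventually_analyticAt,
      hB.eventually_analyticAt] with q hq hXq hAq hBq n
    refine ⟨?_, key _ _ _ hq n⟩
    exact analyticAt_errorLog2 hAq hBq
      ((hXq.add (analyticAt_const.mul hAq)).add (analyticAt_const.mul hBq))
      (hq.pos.trans_le hq.left) (hq.pos.trans_le hq.right) (hq.re_pos n.1 n.2)
  · filter_upwards [h] with q hq
    exact hq.barnesGamma2RightHalf_eq

lemma eventually_isFarRight {X A B : ℂ × ℂ → ℂ} {p : ℂ × ℂ}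
    (hX : ContinuousAt X p) (hA : ContinuousAt A p) (hB : ContinuousAt B p)
    (ha : 0 < (A p).re) (hb : 0 < (B p).re) :
    ∃ (N : ℕ) (δ M : ℝ), ∀ᶠ q in 𝓝 p, IsFarRight δ M (X q + N * B q) (A q) (B q) := by
  set δ := min 1 (min ((A p).re / 2) ((B p).re / 2)) with hδ
  set M := ‖A p‖ + ‖B p‖ + 1 with hM
  have hM0 : ‖A p‖ < M ∧ ‖B p‖ < M := by
    have := norm_nonneg (A p)
    have := norm_nonneg (B p)
    constructor <;> linarith
  have hδA : δ < (A p).re :=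
    ((min_le_right _ _).trans (min_le_left _ _)).trans_lt (half_lt_self ha)
  have hδB : δ < (B p).re :=
    ((min_le_right _ _).trans (min_le_right _ _)).trans_lt (half_lt_self hb)
  obtain ⟨N, hN⟩ := exists_nat_gt ((max 1 (4 * M) - (X p).re) / (B p).re)
  have h1 : max 1 (4 * M) < (X p + N * B p).re := by
    rw [re_add_natCast_mul]
    have := (div_lt_iff₀ hb).1 hN
    linarith
  refine ⟨N, δ, M, ?_⟩
  have hre : ∀ {f : ℂ × ℂ → ℂ}, ContinuousAt f p → ContinuousAt (fun q => (f q).re) p :=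
    fun hf => Complex.continuous_re.continuousAt.comp hf
  filter_upwards [(hre hA).eventually (lt_mem_nhds hδA), (hre hB).eventually (lt_mem_nhds hδB),
    hA.norm.eventually (gt_mem_nhds hM0.1), hB.norm.eventually (gt_mem_nhds hM0.2),
    (hre (hX.add (continuousAt_const.mul hB))).eventually (lt_mem_nhds h1)] with q h1 h2 h3 h4 h5
  exact ⟨lt_min one_pos (lt_min (half_pos ha) (half_pos hb)), min_le_left _ _, h1.le, h2.le, h3.le,
    h4.le, (le_max_left _ _).trans h5.le, (le_max_right _ _).trans h5.le⟩

/-! ### The double gamma function with parameters `1` and `τ` -/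

/-- The scaling factor `τ ^ (-1/2)`, which moves the parameters `1` and `τ` into the right
half-plane. -/
def homScale (τ : ℂ) : ℂ := Complex.exp (-(Complex.log 1 + Complex.log τ) / 2)

lemma barnesGamma2_one (x τ : ℂ) : barnesGamma2 x 1 τ =
    Complex.exp (bernoulli22 x 1 τ * (-(Complex.log 1 + Complex.log τ) / 2) / 2) *
      barnesGamma2RightHalf (homScale τ * x) (homScale τ) (homScale τ * τ) := by
  rw [barnesGamma2, homScale, mul_one]

lemma log_im_mem {τ : ℂ} (hτ : 0 < τ.im) :
    0 ≤ (Complex.log τ).im ∧ (Complex.log τ).im < Real.pi := by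
  rw [Complex.log_im]
  refine ⟨Complex.arg_nonneg_iff.2 hτ.le, lt_of_le_of_ne (Complex.arg_le_pi τ) fun h => ?_⟩
  exact hτ.ne' (Complex.arg_eq_pi_iff.1 h).2

lemma im_half_log (τ : ℂ) :
    (-(Complex.log 1 + Complex.log τ) / 2).im = -((Complex.log τ).im / 2) := by
  rw [Complex.log_one, zero_add, neg_div, Complex.neg_im, Complex.div_ofNat_im]

lemma homScale_re_pos {τ : ℂ} (hτ : 0 < τ.im) : 0 < (homScale τ).re := by
  obtain ⟨h1, h2⟩ := log_im_mem hτ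
  rw [homScale, Complex.exp_re, im_half_log]
  exact mul_pos (Real.exp_pos _) (Real.cos_pos_of_mem_Ioo ⟨by linarith, by linarith [Real.pi_pos]⟩)

lemma homScale_mul_re_pos {τ : ℂ} (hτ : 0 < τ.im) : 0 < (homScale τ * τ).re := by
  obtain ⟨h1, h2⟩ := log_im_mem hτ
  have hτ0 : τ ≠ 0 := by rintro rfl; simp at hτ
  have e : homScale τ * τ = Complex.exp (Complex.log τ / 2) := by
    rw [homScale]
    nth_rewrite 2 [← Complex.exp_log hτ0]
    rw [← Complex.exp_add, Complex.log_one]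
    congr 1
    ring
  rw [e, Complex.exp_re, Complex.div_ofNat_im]
  exact mul_pos (Real.exp_pos _) (Real.cos_pos_of_mem_Ioo ⟨by linarith [Real.pi_pos], by linarith⟩)

lemma log_homScale {τ : ℂ} (hτ : 0 < τ.im) :
    Complex.log (homScale τ) = -(Complex.log 1 + Complex.log τ) / 2 := by
  obtain ⟨h1, h2⟩ := log_im_mem hτ
  refine Complex.log_exp ?_ ?_ <;> rw [im_half_log] <;> linarith [Real.pi_pos]

lemma IsRegularPoint.homScale {x τ : ℂ} (h : IsRegularPoint x 1 τ) :
    IsRegularPoint (homScale τ * x) (homScale τ) (homScale τ * τ) := by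
  intro m n e
  have : QuantumRH.homScale τ * (x + m * 1 + n * τ) = 0 := by rw [← e]; ring
  exact (mul_ne_zero (Complex.exp_ne_zero _) (h m n)) this

lemma barnesGamma2_ne_zero (x a b : ℂ) : barnesGamma2 x a b ≠ 0 :=
  mul_ne_zero (Complex.exp_ne_zero _) (Complex.exp_ne_zero _)

/-- The difference equation `Γ₂(x | 1, τ) = Γ(x) / √(2π) · Γ₂(x + τ | 1, τ)`. -/
lemma barnesGamma2_shift {x τ : ℂ} (hτ : 0 < τ.im) (hx : IsRegularPoint x 1 τ) :
    barnesGamma2 x 1 τ =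
      Complex.Gamma x / (Real.sqrt (2 * Real.pi) : ℂ) * barnesGamma2 (x + τ) 1 τ := by
  have hτ0 : τ ≠ 0 := by rintro rfl; simp at hτ
  have hl : homScale τ ≠ 0 := Complex.exp_ne_zero _
  rw [barnesGamma2_one, barnesGamma2_one, barnesGamma2RightHalf_shift (homScale_re_pos hτ)
    (homScale_mul_re_pos hτ) hx.homScale, progressionGamma, log_homScale hτ,
    mul_div_cancel_left₀ x hl, ← mul_add]
  set m := -(Complex.log 1 + Complex.log τ) / 2
  have e : Complex.exp (bernoulli22 x 1 τ * m / 2) * Complex.exp (m * (x - 1 / 2)) =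
      Complex.exp (bernoulli22 (x + τ) 1 τ * m / 2) := by
    rw [← Complex.exp_add]
    congr 1
    simp only [bernoulli22]
    field_simp
    ring
  rw [← e]
  ring

lemma barnesGamma2_shift_natCast {x τ : ℂ} (hτ : 0 < τ.im) (hx : IsRegularPoint x 1 τ) (N : ℕ) :
    barnesGamma2 x 1 τ =
      (∏ k ∈ Finset.range N, (Complex.Gamma (x + k * τ) / (Real.sqrt (2 * Real.pi) : ℂ))) *
        barnesGamma2 (x + N * τ) 1 τ := by
  have hreg : ∀ N : ℕ, IsRegularPoint (x + N * τ) 1 τ := fun N m n e =>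
    hx m (N + n) (by rw [← e]; push_cast; ring)
  induction N with
  | zero => simp
  | succ N ih =>
    rw [ih, Finset.prod_range_succ, barnesGamma2_shift hτ (hreg N)]
    have : x + ((N + 1 : ℕ) : ℂ) * τ = x + N * τ + τ := by push_cast; ring
    rw [this]
    ring

/-- Where the first `N` gamma factors have no pole, `Γ₂` has none, if `N` shifts lead far to the
right. The value of `Complex.Gamma` at its poles is `0`, so regularity is expressed by `Γ ≠ 0`. -/
lemma isRegularPoint_of_gamma_ne_zero {x τ : ℂ} {N : ℕ} {δ M : ℝ}
    (hN : IsFarRight δ M (homScale τ * x + N * (homScale τ * τ)) (homScale τ) (homScale τ * τ))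
    (h : ∀ k < N, Complex.Gamma (x + k * τ) ≠ 0) : IsRegularPoint x 1 τ := by
  intro m n e
  rcases lt_or_ge n N with hn | hn
  · refine h n hn ?_
    have : x + n * τ = -(m : ℂ) := by linear_combination e
    rw [this, Complex.Gamma_neg_nat_eq_zero]
  · obtain ⟨j, rfl⟩ := Nat.exists_eq_add_of_le hn
    refine hN.ne m j ?_
    have : homScale τ * (x + m * 1 + (N + j : ℕ) * τ) = 0 := by rw [e, mul_zero]
    rw [← this]
    push_cast
    ring

/-- Locally, `Γ₂(ξ | 1, τ)` is a finite product of gamma functions times the exponential of an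
analytic function of `(τ, θ)`, and its poles are those of the product. -/
lemma exists_local_barnesGamma2 {ξ : ℂ × ℂ → ℂ} {p : ℂ × ℂ} (hp : p ∈ HC)
    (hξ : AnalyticAt ℂ ξ p) : ∃ (N : ℕ) (G : ℂ × ℂ → ℂ), AnalyticAt ℂ G p ∧
      ∀ᶠ q in 𝓝 p, (∀ k < N, Complex.Gamma (ξ q + k * q.1) ≠ 0) →
        IsRegularPoint (ξ q) 1 q.1 ∧ barnesGamma2 (ξ q) 1 q.1 =
          (∏ k ∈ Finset.range N, Complex.Gamma (ξ q + k * q.1)) * Complex.exp (G q) := by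
  have hτ : 0 < p.1.im := hp
  have hτ0 : p.1 ≠ 0 := fun h => by simp [h] at hτ
  have hlog : AnalyticAt ℂ (fun q : ℂ × ℂ => Complex.log q.1) p :=
    analyticAt_fst.clog (Or.inr hτ.ne')
  have hm : AnalyticAt ℂ (fun q : ℂ × ℂ => -(Complex.log 1 + Complex.log q.1) / 2) p := by
    fun_prop (disch := norm_num)
  have hA : AnalyticAt ℂ (fun q : ℂ × ℂ => homScale q.1) p := hm.cexp'
  have hB : AnalyticAt ℂ (fun q : ℂ × ℂ => homScale q.1 * q.1) p := hA.mul analyticAt_fst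
  have hX : AnalyticAt ℂ (fun q : ℂ × ℂ => homScale q.1 * ξ q) p := hA.mul hξ
  obtain ⟨N, δ, M, hfar⟩ := eventually_isFarRight hX.continuousAt hA.continuousAt hB.continuousAt
    (homScale_re_pos hτ) (homScale_mul_re_pos hτ)
  obtain ⟨G, hG, hGe⟩ := exists_analyticAt_barnesGamma2RightHalf
    (hX.add (analyticAt_const.mul hB)) hA hB hfar
  have hbern : AnalyticAt ℂ (fun q : ℂ × ℂ => bernoulli22 (ξ q + N * q.1) 1 q.1) p := by
    unfold bernoulli22
    have h1 : (1 : ℂ) * p.1 ≠ 0 := by rwa [one_mul]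
    have h2 : AnalyticAt ℂ (fun q : ℂ × ℂ => q.1) p := analyticAt_fst
    fun_prop (disch := first | assumption | norm_num)
  set c : ℂ := (Real.sqrt (2 * Real.pi) : ℂ)
  have hc : c ≠ 0 := Complex.ofReal_ne_zero.2 (Real.sqrt_ne_zero'.2 Real.two_pi_pos)
  refine ⟨N, fun q => bernoulli22 (ξ q + N * q.1) 1 q.1 *
    (-(Complex.log 1 + Complex.log q.1) / 2) / 2 + G q + N * (-Complex.log c), ?_, ?_⟩
  · exact (((hbern.mul hm).div analyticAt_const two_ne_zero).add hG).add analyticAt_const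
  · have hHC : ∀ᶠ q in 𝓝 p, q ∈ HC := HC.isOpen.mem_nhds hp
    filter_upwards [hfar, hGe, hHC] with q hq hGq hqH hgam
    have hqτ : 0 < q.1.im := hqH
    have hreg := isRegularPoint_of_gamma_ne_zero hq hgam
    refine ⟨hreg, ?_⟩
    rw [barnesGamma2_shift_natCast hqτ hreg N, barnesGamma2_one, Finset.prod_div_distrib,
      Finset.prod_const, Finset.card_range, Complex.exp_add, Complex.exp_add, Complex.exp_nat_mul,
      Complex.exp_neg, Complex.exp_log hc]
    have e : homScale q.1 * (ξ q + N * q.1) =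
        homScale q.1 * ξ q + N * (homScale q.1 * q.1) := by ring
    have hGq' : barnesGamma2RightHalf (homScale q.1 * ξ q + N * (homScale q.1 * q.1))
      (homScale q.1) (homScale q.1 * q.1) = Complex.exp (G q) := hGq
    rw [e, hGq', inv_pow]
    ring

/-! ### The modified gamma functions -/

lemma modGamma2_ne_zero (w η a b : ℂ) : modGamma2 w η a b ≠ 0 :=
  mul_ne_zero (mul_ne_zero (barnesGamma2_ne_zero _ _ _) (Complex.exp_ne_zero _))
    (Complex.exp_ne_zero _)

/-- The difference equation `F(w, η | 1, τ) = Λ(w, η | 1) F(w, η + τ | 1, τ)`. -/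
lemma modGamma2_shift {w η τ : ℂ} (hw : w ≠ 0) (hτ : 0 < τ.im)
    (h : IsRegularPoint (w + η) 1 τ) :
    modGamma2 w η 1 τ = modGamma w η * modGamma2 w (η + τ) 1 τ := by
  have hτ0 : τ ≠ 0 := by rintro rfl; simp at hτ
  rw [modGamma2, modGamma2, modGamma, barnesGamma2_shift hτ h, ← add_assoc,
    Complex.cpow_def_of_ne_zero hw]
  set c : ℂ := (Real.sqrt (2 * Real.pi) : ℂ)
  set m := Complex.log w
  set E := Complex.exp (bernoulli22 (w + η) 1 τ * m / 2)
  have e1 : E * Complex.exp (m * (η + w - 1 / 2)) =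
      Complex.exp (bernoulli22 (w + η + τ) 1 τ * m / 2) := by
    rw [← Complex.exp_add]
    congr 1
    simp only [bernoulli22]
    field_simp
    ring
  have e2 : Complex.exp (-(3 * w ^ 2) / (4 * 1 * τ) - η * w / (1 * τ) +
        w * (1 + τ) / (2 * 1 * τ)) =
      Complex.exp w * Complex.exp (-(3 * w ^ 2) / (4 * 1 * τ) - (η + τ) * w / (1 * τ) +
        w * (1 + τ) / (2 * 1 * τ)) := by
    rw [← Complex.exp_add]
    congr 1
    field_simp
    ring
  rw [← e1, e2]
  have := Complex.exp_ne_zero (m * (η + w - 1 / 2))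
  field_simp

/-- Locally, `F` is the exponential of an analytic function divided by an analytic function `P`,
a finite product of reciprocal gamma functions. The formula holds off the zeros of `P`, which are
the poles of `F`. -/
lemma exists_local_modGamma2 {w : ℂ} {η : ℂ × ℂ → ℂ} {p : ℂ × ℂ} (hp : p ∈ HC)
    (hη : AnalyticAt ℂ η p)
    (hfreq : ∀ k : ℕ, ∃ᶠ q in 𝓝 p, (Complex.Gamma (w + η q + k * q.1))⁻¹ ≠ 0) :
    ∃ G P : ℂ × ℂ → ℂ, AnalyticAt ℂ G p ∧ AnalyticAt ℂ P p ∧ (∃ᶠ q in 𝓝 p, P q ≠ 0) ∧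
      ∀ᶠ q in 𝓝 p, P q ≠ 0 → IsRegularPoint (w + η q) 1 q.1 ∧
        modGamma2 w (η q) 1 q.1 = Complex.exp (G q) / P q := by
  have hτ : 0 < p.1.im := hp
  have hτ0 : p.1 ≠ 0 := fun h => by simp [h] at hτ
  have hξ : AnalyticAt ℂ (fun q => w + η q) p := analyticAt_const.add hη
  obtain ⟨N, G, hG, hloc⟩ := exists_local_barnesGamma2 hp hξ
  have hfst : AnalyticAt ℂ (fun q : ℂ × ℂ => q.1) p := analyticAt_fst
  have hPk : ∀ k : ℕ, AnalyticAt ℂ (fun q => (Complex.Gamma (w + η q + k * q.1))⁻¹) p := by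
    intro k
    have h1 : AnalyticAt ℂ (fun s => (Complex.Gamma s)⁻¹) (w + η p + k * p.1) :=
      Complex.differentiable_one_div_Gamma.analyticAt _
    exact h1.comp (f := fun q : ℂ × ℂ => w + η q + k * q.1)
      (hξ.add (analyticAt_const.mul analyticAt_fst))
  have hP : ∀ N : ℕ,
      AnalyticAt ℂ (fun q => ∏ k ∈ Finset.range N, (Complex.Gamma (w + η q + k * q.1))⁻¹) p ∧
      ∃ᶠ q in 𝓝 p, ∏ k ∈ Finset.range N, (Complex.Gamma (w + η q + k * q.1))⁻¹ ≠ 0 := by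
    intro N
    induction N with
    | zero =>
      simp only [Finset.range_zero, Finset.prod_empty]
      exact ⟨analyticAt_const, (Eventually.of_forall fun _ => one_ne_zero).frequently⟩
    | succ N ih =>
      simp only [Finset.prod_range_succ]
      exact ⟨ih.1.mul (hPk N), frequently_mul_ne_zero ih.1 (hPk N) ih.2 (hfreq N)⟩
  refine ⟨fun q => G q + bernoulli22 (w + η q) 1 q.1 * Complex.log w / 2 +
    (-(3 * w ^ 2) / (4 * 1 * q.1) - η q * w / (1 * q.1) + w * (1 + q.1) / (2 * 1 * q.1)),
    _, ?_, (hP N).1, (hP N).2, ?_⟩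
  · unfold bernoulli22
    have h1 : (1 : ℂ) * p.1 ≠ 0 := by rwa [one_mul]
    have h2 : (4 : ℂ) * 1 * p.1 ≠ 0 := by simpa using hτ0
    have h3 : (2 : ℂ) * 1 * p.1 ≠ 0 := by simpa using hτ0
    fun_prop (disch := first | assumption | norm_num)
  · filter_upwards [hloc] with q hq hPq
    have hgam : ∀ k < N, Complex.Gamma (w + η q + k * q.1) ≠ 0 := fun k hk h0 =>
      hPq (Finset.prod_eq_zero (Finset.mem_range.2 hk) (by rw [h0, inv_zero]))
    obtain ⟨hreg, heq⟩ := hq hgam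
    refine ⟨hreg, ?_⟩
    rw [modGamma2, heq, Finset.prod_inv_distrib, div_inv_eq_mul, Complex.exp_add (G q + _),
      Complex.exp_add (G q)]
    ring

/-! ### Generic points and meromorphy -/

lemma frequently_inv_gamma_ne_zero (d₀ d₁ : ℂ) {c : ℂ} (hc : c ≠ 0) (p : ℂ × ℂ) :
    ∃ᶠ q in 𝓝 p, (Complex.Gamma (d₀ + d₁ * q.1 + c * q.2))⁻¹ ≠ 0 := by
  set e := (d₀ + d₁ * p.1 + c * p.2).im with he
  have hT : Tendsto (fun t : ℝ => (p.1, p.2 + t * Complex.I / c)) (𝓝[>] 0) (𝓝 p) := by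
    have hcont : Continuous fun t : ℝ => (p.1, p.2 + t * Complex.I / c) := by fun_prop
    have := hcont.tendsto 0
    simp only [Complex.ofReal_zero, zero_mul, zero_div, add_zero, Prod.mk.eta] at this
    exact this.mono_left nhdsWithin_le_nhds
  refine hT.frequently (Eventually.frequently ?_)
  have hne : ∀ᶠ t : ℝ in 𝓝[>] 0, e + t ≠ 0 := by
    rcases lt_or_ge e 0 with h | h
    · filter_upwards [nhdsWithin_le_nhds (gt_mem_nhds (show (0 : ℝ) < -e by linarith))] with t ht
      intro h0
      have ht' : t < -e := ht
      linarith
    · filter_upwards [self_mem_nhdsWithin] with t ht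
      have ht' : 0 < t := ht
      intro h0
      linarith
  filter_upwards [hne] with t ht
  refine inv_ne_zero (Complex.Gamma_ne_zero fun m hm => ht ?_)
  have e1 : d₀ + d₁ * p.1 + c * (p.2 + t * Complex.I / c) =
      (d₀ + d₁ * p.1 + c * p.2) + t * Complex.I := by
    field_simp
    ring
  have := congrArg Complex.im hm
  rw [e1] at this
  simpa [he] using this

/-- A property that holds locally away from the zeros of a nonzero analytic function holds
generically. -/
lemma mem_genericFilter {E : Type*} [NormedAddCommGroup E] [NormedSpace ℂ E]
    {U : TopologicalSpace.Opens E} {S : Set E}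
    (h : ∀ p ∈ U, ∃ P : E → ℂ, AnalyticAt ℂ P p ∧ (∃ᶠ x in 𝓝 p, P x ≠ 0) ∧
      ∀ᶠ x in 𝓝 p, P x ≠ 0 → x ∈ S) : S ∈ genericFilter U := by
  refine ⟨interior S, interior_subset, isOpen_interior, fun p hp => ?_⟩
  obtain ⟨P, hP, hfreq, hev⟩ := h p hp
  rw [mem_closure_iff_frequently]
  refine (hfreq.and_eventually (hev.eventually_nhds.and hP.eventually_analyticAt)).mono ?_
  rintro x ⟨hx, hxS, hxP⟩
  rw [mem_interior_iff_mem_nhds]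
  filter_upwards [hxS, hxP.continuousAt.eventually_ne hx] with y hy hy'
  exact hy hy'

section Affine

variable (w c₀ c₁ c₂ : ℂ)

/-- `exists_local_modGamma2` for arguments that are affine in `(τ, θ)`. -/
lemma exists_local_modGamma2_affine (hc : c₂ ≠ 0) {p : ℂ × ℂ} (hp : p ∈ HC) :
    ∃ G P : ℂ × ℂ → ℂ, AnalyticAt ℂ G p ∧ AnalyticAt ℂ P p ∧ (∃ᶠ q in 𝓝 p, P q ≠ 0) ∧
      ∀ᶠ q in 𝓝 p, P q ≠ 0 → IsRegularPoint (w + (c₀ + c₁ * q.1 + c₂ * q.2)) 1 q.1 ∧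
        modGamma2 w (c₀ + c₁ * q.1 + c₂ * q.2) 1 q.1 = Complex.exp (G q) / P q := by
  refine exists_local_modGamma2 hp ?_ fun k => ?_
  · exact (analyticAt_const.add (analyticAt_const.mul analyticAt_fst)).add
      (analyticAt_const.mul analyticAt_snd)
  · refine (frequently_inv_gamma_ne_zero (w + c₀) (c₁ + k) hc p).mono fun q hq => ?_
    convert hq using 3
    ring

lemma isMeromorphicOn_modGamma2 (hc : c₂ ≠ 0) : IsMeromorphicOn (HC : Set (ℂ × ℂ))
    fun q => modGamma2 w (c₀ + c₁ * q.1 + c₂ * q.2) 1 q.1 := by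
  intro p hp
  obtain ⟨G, P, hG, hP, hfreq, h⟩ := exists_local_modGamma2_affine w c₀ c₁ c₂ hc hp
  exact ⟨_, P, hG.cexp', hP, hfreq, h.mono fun q hq hPq => (hq hPq).2⟩

lemma isMeromorphicOn_inv_modGamma2 (hc : c₂ ≠ 0) : IsMeromorphicOn (HC : Set (ℂ × ℂ))
    fun q => (modGamma2 w (c₀ + c₁ * q.1 + c₂ * q.2) 1 q.1)⁻¹ := by
  intro p hp
  obtain ⟨G, P, hG, hP, hfreq, h⟩ := exists_local_modGamma2_affine w c₀ c₁ c₂ hc hp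
  -- The denominator `P` excludes the points where the formula for `F` is not available, and the
  -- square in the numerator makes up for it.
  refine ⟨fun q => P q * P q * Complex.exp (-G q), P, (hP.mul hP).mul hG.neg.cexp', hP, hfreq,
    h.mono fun q hq hPq => ?_⟩
  simp only [(hq hPq).2, Complex.exp_neg]
  field_simp

lemma eventually_isRegularPoint (hc : c₂ ≠ 0) : ∀ᶠ q in genericFilter HC,
    q ∈ HC ∧ IsRegularPoint (w + (c₀ + c₁ * q.1 + c₂ * q.2)) 1 q.1 := by
  refine mem_genericFilter fun p hp => ?_
  obtain ⟨G, P, -, hP, hfreq, h⟩ := exists_local_modGamma2_affine w c₀ c₁ c₂ hc hp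
  refine ⟨P, hP, hfreq, ?_⟩
  filter_upwards [h, HC.isOpen.mem_nhds hp] with q hq hqH hPq
  exact ⟨hqH, (hq hPq).1⟩

end Affine

/-! ### Automorphisms of the extended quantum torus algebra -/

/-- An automorphism of the extended quantum torus algebra is determined by its values on the degree
zero subalgebra and on `y_{α^∨}`. -/
lemma ringEquiv_ext {Ψ Φ : ExtTorus ≃+* ExtTorus} (h0 : ∀ f, Ψ (degZero f) = Φ (degZero f))
    (h1 : Ψ (monom 1 1) = Φ (monom 1 1)) : Ψ = Φ := by
  have hmon : (Ψ : ExtTorus →* ExtTorus).comp (SkewMonoidAlgebra.of (Mer HC) (Multiplicative ℤ)) =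
      (Φ : ExtTorus →* ExtTorus).comp (SkewMonoidAlgebra.of (Mer HC) (Multiplicative ℤ)) :=
    MonoidHom.ext_mint h1
  have hadd : (Ψ : ExtTorus →+ ExtTorus) = (Φ : ExtTorus →+ ExtTorus) := by
    refine SkewMonoidAlgebra.addHom_ext fun n f => ?_
    have e : (SkewMonoidAlgebra.single n f : ExtTorus) =
        degZero f * SkewMonoidAlgebra.of (Mer HC) (Multiplicative ℤ) n := by
      rw [SkewMonoidAlgebra.of_apply]
      change _ = SkewMonoidAlgebra.single 1 f * SkewMonoidAlgebra.single n 1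
      rw [SkewMonoidAlgebra.single_mul_single]
      simp
    have h2 := DFunLike.congr_fun hmon n
    change Ψ _ = Φ _
    rw [e, map_mul, map_mul, h0]
    exact congrArg _ h2
  exact RingEquiv.ext fun a => DFunLike.congr_fun hadd a

/-- The unit of the algebra given by a unit of the degree zero subalgebra. -/
def degZeroUnit (f : (Mer HC)ˣ) : ExtTorusˣ := Units.map (degZero : Mer HC →* ExtTorus) f

lemma Ad_degZeroUnit_degZero (f : (Mer HC)ˣ) (g : Mer HC) :
    Ad (degZeroUnit f) (degZero g) = degZero g := by
  change degZero (f : Mer HC) * degZero g * degZero ((f⁻¹ : (Mer HC)ˣ) : Mer HC) = _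
  rw [← map_mul, ← map_mul, mul_right_comm, Units.mul_inv, one_mul]

lemma Ad_degZeroUnit_monom (f : (Mer HC)ˣ) : Ad (degZeroUnit f) (monom 1 1) =
    monom ((f : Mer HC) * shiftMer 1 ((f⁻¹ : (Mer HC)ˣ) : Mer HC)) 1 := by
  change monom (f : Mer HC) 0 * monom 1 1 * monom ((f⁻¹ : (Mer HC)ˣ) : Mer HC) 0 = _
  rw [monom_mul_monom, monom_mul_monom, add_zero, zero_add]
  have : shiftMer 0 (1 : Mer HC) = 1 := rfl
  rw [this, mul_one]

lemma wArg_ne_zero {z t : ℂ} {σ : ℤˣ} (hz : z ≠ 0) (ht : t ≠ 0) : wArg z σ t ≠ 0 := by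
  have hσ : ((σ : ℤ) : ℂ) ≠ 0 := Int.cast_ne_zero.2 σ.ne_zero
  exact div_ne_zero (mul_ne_zero hσ hz) (mul_ne_zero Complex.two_pi_I_ne_zero ht)

lemma eta_affine (σ : ℤˣ) (q : ℂ × ℂ) : (1 + q.1) / 2 - ((σ : ℤ) : ℂ) * q.2 =
    1 / 2 + 1 / 2 * q.1 + -((σ : ℤ) : ℂ) * q.2 := by
  ring

lemma psiFun_eq (z : ℂ) (σ : ℤˣ) (t : ℂ) : psiFun z σ t = fun q =>
    (modGamma2 (wArg z σ t) (1 / 2 + 1 / 2 * q.1 + -((σ : ℤ) : ℂ) * q.2) 1 q.1)⁻¹ :=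
  funext fun q => by rw [psiFun, eta_affine]

/-- The function `ψ_±(t)` as a unit of `ℳ(ℋ × ℂ)`. -/
def psiUnit (z : ℂ) (σ : ℤˣ) (t : ℂ) : (Mer HC)ˣ where
  val := ⟨(psiFun z σ t : Germ (genericFilter HC) ℂ), psiFun z σ t, by
    simpa only [psiFun_eq] using isMeromorphicOn_inv_modGamma2 (wArg z σ t) (1 / 2) (1 / 2)
      (-((σ : ℤ) : ℂ)) (neg_ne_zero.2 (Int.cast_ne_zero.2 σ.ne_zero)), rfl⟩
  inv := ⟨((fun q => (psiFun z σ t q)⁻¹ : ℂ × ℂ → ℂ) : Germ (genericFilter HC) ℂ),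
    fun q => (psiFun z σ t q)⁻¹, by
    simpa only [psiFun_eq, inv_inv] using isMeromorphicOn_modGamma2 (wArg z σ t) (1 / 2)
      (1 / 2) (-((σ : ℤ) : ℂ)) (neg_ne_zero.2 (Int.cast_ne_zero.2 σ.ne_zero)), rfl⟩
  val_inv := Subtype.ext (congrArg (fun u : ℂ × ℂ → ℂ => (u : Germ (genericFilter HC) ℂ))
    (funext fun _ => mul_inv_cancel₀ (inv_ne_zero (modGamma2_ne_zero _ _ _ _))))
  inv_val := Subtype.ext (congrArg (fun u : ℂ × ℂ → ℂ => (u : Germ (genericFilter HC) ℂ))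
    (funext fun _ => inv_mul_cancel₀ (inv_ne_zero (modGamma2_ne_zero _ _ _ _))))

/-- The factor `ψ(τ, θ) ψ(τ, θ + τ)⁻¹` of `Ad ψ` at points where the difference equation of `F`
holds; it is used at `1 / 2 - (θ + τ / 2)` for the upper sign and at `(1 + τ) / 2 + θ` for the lower
one. -/
lemma psiFun_mul_inv_shift {z t : ℂ} {σ : ℤˣ} (hz : z ≠ 0) (ht : t ≠ 0) {q : ℂ × ℂ} (hq : q ∈ HC)
    (h : IsRegularPoint (wArg z σ t + (1 / 2 - (σ : ℤ) * (q.2 + q.1 / 2))) 1 q.1) :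
    psiFun z σ t q * (psiFun z σ t (shift 1 q))⁻¹ =
      modGamma (wArg z σ t) (1 / 2 - (σ : ℤ) * (q.2 + q.1 / 2)) ^ (σ : ℤ) := by
  have hs := modGamma2_shift (wArg_ne_zero (σ := σ) hz ht) hq h
  simp only [psiFun, shift, inv_inv]
  rcases Int.units_eq_one_or σ with rfl | rfl
  · have e1 : (1 / 2 - (((1 : ℤˣ) : ℤ) : ℂ) * (q.2 + q.1 / 2)) + q.1 =
        (1 + q.1) / 2 - (((1 : ℤˣ) : ℤ) : ℂ) * q.2 := by
      push_cast
      ring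
    have e2 : (1 + q.1) / 2 - (((1 : ℤˣ) : ℤ) : ℂ) * (q.2 + ((1 : ℤ) : ℂ) * q.1) =
        1 / 2 - (((1 : ℤˣ) : ℤ) : ℂ) * (q.2 + q.1 / 2) := by
      push_cast
      ring
    rw [e1] at hs
    rw [e2, hs, Units.val_one, zpow_one, mul_comm, mul_assoc,
      mul_inv_cancel₀ (modGamma2_ne_zero _ _ _ _), mul_one]
  · have e1 : 1 / 2 - (((-1 : ℤˣ) : ℤ) : ℂ) * (q.2 + q.1 / 2) =
        (1 + q.1) / 2 - (((-1 : ℤˣ) : ℤ) : ℂ) * q.2 := by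
      push_cast
      ring
    have e2 : (1 + q.1) / 2 - (((-1 : ℤˣ) : ℤ) : ℂ) * (q.2 + ((1 : ℤ) : ℂ) * q.1) =
        (1 + q.1) / 2 - (((-1 : ℤˣ) : ℤ) : ℂ) * q.2 + q.1 := by
      push_cast
      ring
    rw [e1] at hs ⊢
    rw [e2, hs, Units.val_neg, Units.val_one, zpow_neg_one, mul_inv, mul_assoc,
      inv_mul_cancel₀ (modGamma2_ne_zero _ _ _ _), mul_one]

lemma represents_psiUnit_mul_shift {z t : ℂ} (σ : ℤˣ) (hz : z ≠ 0) (ht : t ≠ 0) :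
    Represents ((psiUnit z σ t : Mer HC) * shiftMer 1 (((psiUnit z σ t)⁻¹ : (Mer HC)ˣ) : Mer HC))
      (fun p => modGamma (wArg z σ t) (1 / 2 - (σ : ℤ) * (p.2 + p.1 / 2)) ^ (σ : ℤ)) := by
  have hσ : ((σ : ℤ) : ℂ) ≠ 0 := Int.cast_ne_zero.2 σ.ne_zero
  have hreg := eventually_isRegularPoint (wArg z σ t) (1 / 2) (-((σ : ℤ) : ℂ) / 2)
    (-((σ : ℤ) : ℂ)) (neg_ne_zero.2 hσ)
  refine Germ.coe_eq.2 ?_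
  filter_upwards [hreg] with q hq
  refine psiFun_mul_inv_shift hz ht hq.1 ?_
  convert hq.2 using 2
  ring

lemma isSolution_Ad {z t : ℂ} (σ : ℤˣ) (hz : z ≠ 0) (ht : t ≠ 0) :
    IsSolution z σ t (Ad (degZeroUnit (psiUnit z σ t))) :=
  ⟨Ad_degZeroUnit_degZero _, _, represents_psiUnit_mul_shift σ hz ht, Ad_degZeroUnit_monom _⟩

lemma IsSolution.unique {z t : ℂ} {σ : ℤˣ} {Ψ Φ : ExtTorus ≃+* ExtTorus}
    (h : IsSolution z σ t Ψ) (h' : IsSolution z σ t Φ) : Ψ = Φ := by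
  obtain ⟨L, hL, e⟩ := h.map_y
  obtain ⟨L', hL', e'⟩ := h'.map_y
  have : L = L' := Subtype.ext (hL.trans hL'.symm)
  exact ringEquiv_ext (fun f => (h.degZero_fixed f).trans (h'.degZero_fixed f).symm)
    (by rw [e, e', this])

end QuantumRH

end

theorem theorem3p3 (z : ℂ) (hz : z ≠ 0) (σ : ℤˣ) :
    ∃ ψ : tDomain z σ → ExtTorusˣ, ∀ t : tDomain z σ,
      (∃ f : Mer HC, Represents f (psiFun z σ t) ∧ (ψ t : ExtTorus) = degZero f) ∧
      ∀ Ψ : ExtTorus ≃+* ExtTorus, IsSolution z σ t Ψ ↔ Ψ = Ad (ψ t) := by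
  refine ⟨fun t => degZeroUnit (psiUnit z σ t), fun t => ⟨⟨psiUnit z σ t, rfl, rfl⟩, fun Ψ => ?_⟩⟩
  have hsol := isSolution_Ad σ hz t.2.1
  constructor
  · exact fun h => h.unique hsol
  · rintro rfl
    exact hsol
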